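/- Let $d\ge 0$. A set $X\subseteq\mathbb R^d$ is a *Delaunay set* if there are $0<r<R$ such that every open ball of radius $r$ contains at most one point of $X$ and every closed ball of radius $R$ contains at least one point of $X$; a set $X\subseteq\mathbb R^d$ is *generic* if no $d+2$ of its points lie on a common $(d-1)$-sphere. A *triangulation* of a Delaunay set $X$ is a geometric simplicial complex with vertex set $X$ and underlying space $\mathbb R^d$; for a finite set $Y$ the underlying space is required to be $\operatorname{conv}Y$ instead. A triangulation is *uniformly bounded* if there is $q\in\mathbb R$ such that all its $d$-simplices have circumradius at most $q$. For a generic set $X$ that is finite or a Delaunay set, $\operatorname{Del}X$ consists of all (non-degenerate) $d$-simplices with vertices in $X$ whose open circumscribed ball contains no point of $X$, together with their faces. Let $\mathcal E$ be the class of real-valued functionals $F$ on the $d$-simplices of $\mathbb R^d$ such that for all $r,q>0$ there are constants $e,E$ with $e\le F(\sigma)\le E$ for every $d$-simplex $\sigma$ with all edges of length at least $2r$ and circumradius at most $q$. For a collection $T$ of simplices put $$f(T)=\liminf_{\alpha\to\infty}\frac1{\operatorname{vol}(B_\alpha)}\sum_{\sigma\in T,\ \sigma\subseteq B_\alpha}F(\sigma),$$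 where $B_\alpha$ is the closed ball of radius $\alpha$ centered at the origin and the sum is over $d$-simplices. Let $\mathcal F\subseteq\mathcal E$ consist of the $F\in\mathcal E$ such that, for every generic set $Y$ of $d+2$ points in $\mathbb R^d$ none of which lies in the convex hull of the others, the sum of $F$ over the $d$-simplices of $\operatorname{Del}Y$ is at most the sum of $F$ over the $d$-simplices of any triangulation of $Y$. Let $\mathcal G\subseteq\mathcal E$ consist of the $F\in\mathcal E$ such that, for every finite generic set $Y\subseteq\mathbb R^d$ and every simplicial complex $T'$ with vertex set $Y$ (not necessarily a triangulation of $Y$), the sum of $F$ over the $d$-simplices of $\operatorname{Del}Y$ that are contained in the underlying space of $T'$ is at most the sum of $F$ over the $d$-simplices of $T'$. **Theorem.** Let $X$ be a generic Delaunay set in $\mathbb R^d$. (i) If $d=2$ and $F\in\mathcal F$, then $f(\operatorname{Del}X)\le f(T)$ for every uniformly bounded triangulation $T$ of $X$. (ii) For arbitrary $d$, if $F\in\mathcal G$, then $f(\operatorname{Del}X)\le f(T)$ for every uniformly bounded triangulation $T$ of $X$. -/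

import Mathlib

open Set Filter MeasureTheory Metric

noncomputable section

/-- Euclidean `d`-space. -/
abbrev Pt (d : ℕ) : Type := EuclideanSpace ℝ (Fin d)

/-- `X` is a Delaunay set (an `(r, R)`-system): there are `0 < r < R` such that every open ball of
radius `r` contains at most one point of `X`, and every closed ball of radius `R` contains at least
one point of `X`. -/
def IsDelaunaySet {d : ℕ} (X : Set (Pt d)) : Prop :=
  ∃ r R : ℝ, 0 < r ∧ r < R ∧
    (∀ z : Pt d, (X ∩ ball z r).Subsingleton) ∧
    (∀ z : Pt d, (X ∩ closedBall z R).Nonempty)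

/-- `X` is generic: no `d + 2` points of `X` lie on a common `(d - 1)`-sphere. -/
def IsGeneric {d : ℕ} (X : Set (Pt d)) : Prop :=
  ∀ s : Finset (Pt d), (s : Set (Pt d)) ⊆ X → s.card = d + 2 →
    ¬ EuclideanGeometry.Cospherical (s : Set (Pt d))

/-- The (non-degenerate) `d`-simplices in `ℝ^d`, each given by its set of `d + 1` affinely
independent vertices. -/
def DSimplex (d : ℕ) : Type :=
  {s : Finset (Pt d) // s.card = d + 1 ∧ AffineIndependent ℝ ((↑) : s → Pt d)}

/-- The vertex set of a `d`-simplex. -/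
def DSimplex.verts {d : ℕ} (σ : DSimplex d) : Finset (Pt d) := σ.1

/-- The `d`-simplex as a set of points. -/
def DSimplex.body {d : ℕ} (σ : DSimplex d) : Set (Pt d) :=
  convexHull ℝ (σ.verts : Set (Pt d))

/-- The sphere with center `c` and radius `ρ` passes through all vertices of `σ`. (A non-degenerate
`d`-simplex in `ℝ^d` has exactly one such sphere.) -/
def DSimplex.IsCircumsphere {d : ℕ} (σ : DSimplex d) (c : Pt d) (ρ : ℝ) : Prop :=
  ∀ x ∈ σ.verts, dist x c = ρ

/-- The circumradius of `σ` is at most `q`. -/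
def DSimplex.CircumradiusLE {d : ℕ} (σ : DSimplex d) (q : ℝ) : Prop :=
  ∃ (c : Pt d) (ρ : ℝ), σ.IsCircumsphere c ρ ∧ ρ ≤ q

/-- The `d`-simplex `σ` has its vertices in `X` and is empty: the open ball bounded by its
circumsphere contains no points of `X`. -/
def DSimplex.IsEmptyIn {d : ℕ} (σ : DSimplex d) (X : Set (Pt d)) : Prop :=
  (σ.verts : Set (Pt d)) ⊆ X ∧
    ∃ (c : Pt d) (ρ : ℝ), σ.IsCircumsphere c ρ ∧ X ∩ ball c ρ = ∅

/-- The Delaunay triangulation of `X` (finite or infinite), as a collection of simplices given by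
their vertex sets: the empty `d`-simplices of `X` together with their faces. -/
def delaunay {d : ℕ} (X : Set (Pt d)) : Set (Finset (Pt d)) :=
  {t | t.Nonempty ∧ ∃ σ : DSimplex d, σ.IsEmptyIn X ∧ t ⊆ σ.verts}

/-- `T` is a triangulation of the Delaunay set `X`: a simplicial complex with vertex set `X` and
underlying space `ℝ^d`. -/
def IsTriangulation {d : ℕ} (T : Geometry.SimplicialComplex ℝ (Pt d)) (X : Set (Pt d)) : Prop :=
  T.vertices = X ∧ T.space = univ

/-- `T` is a triangulation of the finite set `Y`: a simplicial complex with vertex set `Y` whose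
underlying space is the convex hull of `Y`. -/
def IsFiniteTriangulation {d : ℕ} (T : Geometry.SimplicialComplex ℝ (Pt d))
    (Y : Finset (Pt d)) : Prop :=
  T.vertices = (Y : Set (Pt d)) ∧ T.space = convexHull ℝ (Y : Set (Pt d))

/-- `T` is uniformly bounded: the circumradii of its `d`-simplices are bounded by a constant. -/
def IsUniformlyBounded {d : ℕ} (T : Geometry.SimplicialComplex ℝ (Pt d)) : Prop :=
  ∃ q : ℝ, ∀ σ : DSimplex d, σ.verts ∈ T.faces → σ.CircumradiusLE q

/-- The sum of `F` over the `d`-simplices of the collection `K` that are contained in `A`. In all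
uses below only finitely many simplices contribute. -/
def simplexSum {d : ℕ} (F : DSimplex d → ℝ) (K : Set (Finset (Pt d))) (A : Set (Pt d)) : ℝ :=
  ∑ᶠ σ ∈ {σ : DSimplex d | σ.verts ∈ K ∧ σ.body ⊆ A}, F σ

/-- The density of `F` on the collection `K` of simplices: the lower limit, as `α → ∞`, of the sum
of `F` over the `d`-simplices of `K` contained in the closed ball of radius `α` centered at the
origin, divided by the volume of that ball. The lower limit is taken in the extended reals. -/
def density {d : ℕ} (F : DSimplex d → ℝ) (K : Set (Finset (Pt d))) : EReal :=
  liminf (fun α : ℝ =>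
    ((simplexSum F K (closedBall (0 : Pt d) α) / volume.real (closedBall (0 : Pt d) α) : ℝ) : EReal))
    atTop

/-- The class of functionals on `d`-simplices that are bounded, for all `r, q > 0`, on the
`d`-simplices with edges of length at least `2 r` and circumradius at most `q`. -/
def ClassE (d : ℕ) : Set (DSimplex d → ℝ) :=
  {F | ∀ r q : ℝ, 0 < r → 0 < q → ∃ e E : ℝ, ∀ σ : DSimplex d,
    (∀ x ∈ σ.verts, ∀ y ∈ σ.verts, x ≠ y → 2 * r ≤ dist x y) → σ.CircumradiusLE q →
      e ≤ F σ ∧ F σ ≤ E}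

/-- The class of functionals `F` in `ClassE d` such that, for every generic set `Y` of `d + 2`
points none of which lies in the convex hull of the others, the sum of `F` over the `d`-simplices of
the Delaunay triangulation of `Y` is at most the sum over those of any triangulation of `Y`. (There
are only two triangulations of such a set, exchanged by the flip.) -/
def ClassF (d : ℕ) : Set (DSimplex d → ℝ) :=
  {F | F ∈ ClassE d ∧ ∀ Y : Finset (Pt d), Y.card = d + 2 → IsGeneric (Y : Set (Pt d)) →
    (∀ y ∈ Y, y ∉ convexHull ℝ ((Y : Set (Pt d)) \ {y})) →
    ∀ T : Geometry.SimplicialComplex ℝ (Pt d), IsFiniteTriangulation T Y →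
      simplexSum F (delaunay (Y : Set (Pt d))) univ ≤ simplexSum F T.faces univ}

/-- The class of functionals `F` in `ClassE d` such that, for every finite generic set `Y` and every
simplicial complex `T'` with vertex set `Y` (not necessarily a triangulation of `Y`), the sum of `F`
over the `d`-simplices of the Delaunay triangulation of `Y` contained in the underlying space of
`T'` is at most the sum of `F` over the `d`-simplices of `T'`. -/
def ClassG (d : ℕ) : Set (DSimplex d → ℝ) :=
  {F | F ∈ ClassE d ∧ ∀ Y : Finset (Pt d), IsGeneric (Y : Set (Pt d)) →
    ∀ T' : Geometry.SimplicialComplex ℝ (Pt d), T'.vertices = (Y : Set (Pt d)) →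
      simplexSum F (delaunay (Y : Set (Pt d))) T'.space ≤ simplexSum F T'.faces univ}

end

/-! Both parts compare sums over a ball of radius `α` and discard simplices near its boundary. Any
discrepancy is confined to simplices of bounded circumradius whose vertices lie in `X` and in a
shell of fixed width. Packing gives `O(α ^ (d - 1))` of these for `d ≥ 1` and none for large `α`
when `d = 0`; `F` is bounded on them, so after division by the volume they do not affect the lower
limit (`density_le_of_shell`).

For `ClassG`, the hypothesis is applied to the points of `X` in a slightly larger ball and to the
complex of faces of `T` in the ball of radius `α`, with the remaining points added as isolated
vertices. These extra points ensure that a simplex in the ball of radius `α` is empty for the finite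
set exactly when it is empty for `X` (`DSimplex.IsEmptyIn.of_inter_closedBall`). The Delaunay
simplices of the ball not covered by the complex lie in a shell.

For `ClassF` in the plane, the triangles of `T` in the ball form a finite patch, which is improved
by edge flips. A flip towards Delaunay keeps the region covered, does not increase the sum of `F`
(`add_le_add_of_mem_classF`), keeps the circumradius bound (`circumradius_le_max`) and strictly
lowers the volume under the lift to the paraboloid (`Crossing.liftedVolume_lt`). Only finitely many
patches are possible, so a minimizer of that volume admits no further flip. Away from the boundary
such a patch is Delaunay: a power-of-a-point argument (`IsPatch.le_dist_of_isLocallyDelaunay`)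
empties the circumdiscs of its deep triangles, and genericity (`DSimplex.IsEmptyIn.eq_of_mem_body`)
shows that every deep Delaunay triangle occurs in it. -/

/-! ### Delaunay sets: packing -/

/-- Distinct points of `X` have distance at least `2 r`. -/
def IsSparse {d : ℕ} (X : Set (Pt d)) (r : ℝ) : Prop :=
  ∀ x ∈ X, ∀ y ∈ X, x ≠ y → 2 * r ≤ dist x y

theorem isSparse_of_subsingleton_inter_ball {d : ℕ} {X : Set (Pt d)} {r : ℝ}
    (h : ∀ z : Pt d, (X ∩ ball z r).Subsingleton) : IsSparse X r := by
  intro x hx y hy hxy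
  by_contra! hlt
  have h1 : dist x (midpoint ℝ x y) < r := by
    rw [dist_left_midpoint, Real.norm_ofNat]; linarith
  have h2 : dist y (midpoint ℝ x y) < r := by
    rw [dist_right_midpoint, Real.norm_ofNat]; linarith
  exact hxy (h _ ⟨hx, h1⟩ ⟨hy, h2⟩)

theorem IsSparse.card_mul_le {d : ℕ} {X : Set (Pt d)} {r : ℝ} (hX : IsSparse X r)
    (s : Finset (Pt d)) (hs : (s : Set (Pt d)) ⊆ X) {U : Set (Pt d)} (hU : Bornology.IsBounded U)
    (hsU : ∀ x ∈ s, ball x r ⊆ U) :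
    s.card * volume.real (ball (0 : Pt d) r) ≤ volume.real U := by
  have hdisj : PairwiseDisjoint (s : Set (Pt d)) (fun x => ball x r) := by
    intro x hx y hy hxy
    apply ball_disjoint_ball
    linarith [hX x (hs hx) y (hs hy) hxy]
  have h := measureReal_biUnion_finset (μ := (volume : Measure (Pt d))) hdisj
    (fun b _ => measurableSet_ball) (fun b _ => measure_ball_lt_top.ne)
  have h2 : ∀ x : Pt d, volume.real (ball x r) = volume.real (ball (0 : Pt d) r) := fun x => by
    simp [measureReal_def, Measure.addHaar_ball_center]
  simp only [h2, Finset.sum_const, nsmul_eq_mul] at h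
  rw [← h]
  exact measureReal_mono (iUnion₂_subset hsU) hU.measure_lt_top.ne

theorem volume_real_ball_pos {d : ℕ} {r : ℝ} (hr : 0 < r) : 0 < volume.real (ball (0 : Pt d) r) :=
  ENNReal.toReal_pos (measure_ball_pos _ _ hr).ne' measure_ball_lt_top.ne

theorem IsSparse.exists_card_le {d : ℕ} {X : Set (Pt d)} {r : ℝ} (hr : 0 < r) (hX : IsSparse X r)
    (ρ : ℝ) : ∃ N : ℕ, ∀ (z : Pt d) (s : Finset (Pt d)), (s : Set (Pt d)) ⊆ X ∩ closedBall z ρ →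
      s.card ≤ N := by
  refine ⟨⌈volume.real (closedBall (0 : Pt d) (ρ + r)) / volume.real (ball (0 : Pt d) r)⌉₊,
    fun z s hs => ?_⟩
  have h := hX.card_mul_le s (fun x hx => (hs hx).1) (U := closedBall z (ρ + r))
    isBounded_closedBall (fun x hx => by
      intro y hy
      have h1 := (hs hx).2
      rw [mem_closedBall] at h1 ⊢
      rw [mem_ball] at hy
      linarith [dist_triangle y x z])
  rw [Measure.addHaar_real_closedBall_center, ← le_div_iff₀ (volume_real_ball_pos hr)] at h
  exact_mod_cast h.trans (Nat.le_ceil _)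

theorem Set.finite_of_forall_finset_card_le {α : Type*} {s : Set α} (N : ℕ)
    (h : ∀ t : Finset α, (t : Set α) ⊆ s → t.card ≤ N) : s.Finite := by
  by_contra hs
  obtain ⟨t, ht, hc⟩ := Set.Infinite.exists_subset_card_eq hs (N + 1)
  have := h t ht
  omega

theorem IsSparse.finite_inter_closedBall {d : ℕ} {X : Set (Pt d)} {r : ℝ} (hr : 0 < r)
    (hX : IsSparse X r) (z : Pt d) (ρ : ℝ) : (X ∩ closedBall z ρ).Finite := by
  obtain ⟨N, hN⟩ := hX.exists_card_le hr ρ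
  exact Set.finite_of_forall_finset_card_le N (hN z)

theorem IsSparse.countable {d : ℕ} {X : Set (Pt d)} {r : ℝ} (hr : 0 < r) (hX : IsSparse X r) :
    X.Countable := by
  have : X = ⋃ n : ℕ, X ∩ closedBall 0 n := by
    rw [← inter_iUnion, iUnion_closedBall_nat, inter_univ]
  rw [this]
  exact countable_iUnion fun n => (hX.finite_inter_closedBall hr 0 n).countable

/-! ### Simplices -/

@[ext]
theorem DSimplex.ext {d : ℕ} {σ τ : DSimplex d} (h : σ.verts = τ.verts) : σ = τ :=
  Subtype.ext h

theorem DSimplex.card_verts {d : ℕ} (σ : DSimplex d) : σ.verts.card = d + 1 := σ.2.1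

theorem DSimplex.nonempty_verts {d : ℕ} (σ : DSimplex d) : σ.verts.Nonempty :=
  Finset.card_pos.1 (by rw [σ.card_verts]; omega)

theorem DSimplex.eq_of_subset {d : ℕ} {σ τ : DSimplex d} (h : σ.verts ⊆ τ.verts) : σ = τ :=
  DSimplex.ext (Finset.eq_of_subset_of_card_le h (by rw [σ.card_verts, τ.card_verts]))

theorem DSimplex.verts_subset_body {d : ℕ} (σ : DSimplex d) : (σ.verts : Set (Pt d)) ⊆ σ.body :=
  subset_convexHull ℝ _

theorem DSimplex.body_subset_iff {d : ℕ} (σ : DSimplex d) {A : Set (Pt d)} (hA : Convex ℝ A) :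
    σ.body ⊆ A ↔ (σ.verts : Set (Pt d)) ⊆ A :=
  ⟨σ.verts_subset_body.trans, fun h => convexHull_min h hA⟩

theorem DSimplex.isCompact_body {d : ℕ} (σ : DSimplex d) : IsCompact σ.body :=
  σ.verts.finite_toSet.isCompact_convexHull ℝ

theorem DSimplex.IsCircumsphere.body_subset {d : ℕ} {σ : DSimplex d} {c : Pt d} {ρ : ℝ}
    (h : σ.IsCircumsphere c ρ) : σ.body ⊆ closedBall c ρ :=
  (σ.body_subset_iff (convex_closedBall c ρ)).2 fun x hx => (h x hx).le

theorem DSimplex.IsCircumsphere.nonneg {d : ℕ} {σ : DSimplex d} {c : Pt d} {ρ : ℝ}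
    (h : σ.IsCircumsphere c ρ) : 0 ≤ ρ := by
  obtain ⟨x, hx⟩ := σ.nonempty_verts
  exact (h x hx) ▸ dist_nonneg

theorem DSimplex.CircumradiusLE.dist_le {d : ℕ} {σ : DSimplex d} {q : ℝ}
    (h : σ.CircumradiusLE q) {x y : Pt d} (hx : x ∈ σ.body) (hy : y ∈ σ.body) :
    dist x y ≤ 2 * q := by
  obtain ⟨c, ρ, hc, hρ⟩ := h
  have h1 := mem_closedBall.1 (hc.body_subset hx)
  have h2 := mem_closedBall.1 (hc.body_subset hy)
  linarith [dist_triangle_right x y c]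

theorem DSimplex.CircumradiusLE.mono {d : ℕ} {σ : DSimplex d} {p q : ℝ}
    (h : σ.CircumradiusLE p) (hpq : p ≤ q) : σ.CircumradiusLE q := by
  obtain ⟨c, ρ, hc, hρ⟩ := h
  exact ⟨c, ρ, hc, hρ.trans hpq⟩

theorem DSimplex.verts_mem_delaunay {d : ℕ} {σ : DSimplex d} {X : Set (Pt d)} :
    σ.verts ∈ delaunay X ↔ σ.IsEmptyIn X := by
  refine ⟨fun ⟨_, τ, hτ, h⟩ => ?_, fun h => ⟨σ.nonempty_verts, σ, h, subset_rfl⟩⟩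
  rwa [DSimplex.eq_of_subset h]

theorem DSimplex.IsEmptyIn.circumradiusLE {d : ℕ} {σ : DSimplex d} {X : Set (Pt d)} {R : ℝ}
    (hR : ∀ z : Pt d, (X ∩ closedBall z R).Nonempty) (h : σ.IsEmptyIn X) :
    σ.CircumradiusLE R := by
  obtain ⟨-, c, ρ, hc, he⟩ := h
  refine ⟨c, ρ, hc, ?_⟩
  by_contra! hlt
  obtain ⟨x, hx, hxc⟩ := hR c
  exact (he.subset ⟨hx, (mem_closedBall.1 hxc).trans_lt hlt⟩ : x ∈ (∅ : Set (Pt d)))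

theorem finite_dSimplex_verts_subset {d : ℕ} {Y : Set (Pt d)} (hY : Y.Finite) :
    {σ : DSimplex d | (σ.verts : Set (Pt d)) ⊆ Y}.Finite := by
  refine Set.Finite.of_injOn (f := DSimplex.verts) (t := {s : Finset (Pt d) | (s : Set (Pt d)) ⊆ Y})
    (fun σ hσ => hσ) (fun σ _ τ _ h => DSimplex.ext h)
    (hY.toFinset.powerset.finite_toSet.subset fun s hs => ?_)
  simpa [Finset.subset_iff] using hs

/-! ### Counting simplices in a shell -/

/-- The simplex `σ` has its vertices in `X` and in the shell `α - C < ‖x‖ ≤ α`. -/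
def DSimplex.InShell {d : ℕ} (σ : DSimplex d) (X : Set (Pt d)) (C α : ℝ) : Prop :=
  (σ.verts : Set (Pt d)) ⊆ X ∧ ∀ x ∈ σ.verts, ‖x‖ ≤ α ∧ α - C < ‖x‖

/-- Choose one vertex per simplex. A point is chosen at most `2 ^ N` times, since the vertex sets
involved are subsets of the at most `N` points of `X` within `2 * q` of it. The chosen points carry
disjoint `r`-balls inside the shell widened by `r` on both sides; `C + r ≤ α` keeps its inner radius
nonnegative. -/
theorem IsSparse.exists_card_shell_le {d : ℕ} {X : Set (Pt d)} {r : ℝ} (hr : 0 < r)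
    (hX : IsSparse X r) (q : ℝ) {C : ℝ} (hC : 0 ≤ C) : ∃ N : ℝ,
    ∀ (α : ℝ) (S : Finset (DSimplex d)), C + r ≤ α →
      (∀ σ ∈ S, σ.CircumradiusLE q ∧ σ.InShell X C α) →
      (S.card : ℝ) ≤ N * ((α + r) ^ d - (α - C - r) ^ d) := by
  classical
  obtain ⟨N, hN⟩ := hX.exists_card_le hr (2 * q)
  refine ⟨(2 ^ N : ℕ) * (volume.real (ball (0 : Pt d) 1) / volume.real (ball (0 : Pt d) r)),
    fun α S hα hS => ?_⟩
  choose f hf using fun σ : DSimplex d => σ.nonempty_verts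
  have hcard : S.card ≤ 2 ^ N * (S.image f).card := by
    refine Finset.card_le_mul_card_image S _ fun x hx => ?_
    have hfin := hX.finite_inter_closedBall hr x (2 * q)
    have hle := hN x hfin.toFinset (by simp)
    calc _ ≤ hfin.toFinset.powerset.card := by
          refine Finset.card_le_card_of_injOn DSimplex.verts (fun σ hσ => ?_)
            (fun σ _ τ _ h => DSimplex.ext h)
          simp only [Finset.coe_filter, mem_ofPred_eq] at hσ
          simp only [Finset.coe_powerset, mem_preimage, mem_powerset_iff, Finite.coe_toFinset]
          intro y hy
          refine ⟨(hS σ hσ.1).2.1 hy, ?_⟩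
          rw [← hσ.2]
          exact (hS σ hσ.1).1.dist_le (σ.verts_subset_body hy) (σ.verts_subset_body (hf σ))
      _ = 2 ^ hfin.toFinset.card := Finset.card_powerset _
      _ ≤ 2 ^ N := Nat.pow_le_pow_right (by norm_num) hle
  have himg : ((S.image f).card : ℝ) * volume.real (ball (0 : Pt d) r) ≤
      ((α + r) ^ d - (α - C - r) ^ d) * volume.real (ball (0 : Pt d) 1) := by
    have h := hX.card_mul_le (S.image f) (U := closedBall 0 (α + r) \ closedBall 0 (α - C - r)) ?_
      (isBounded_closedBall.subset sdiff_subset) ?_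
    · rw [measureReal_sdiff (closedBall_subset_closedBall (by linarith)) measurableSet_closedBall
        measure_closedBall_lt_top.ne,
        Measure.addHaar_real_closedBall _ _ (by linarith),
        Measure.addHaar_real_closedBall _ _ (by linarith)] at h
      simpa [sub_mul] using h
    · intro x hx
      simp only [Finset.coe_image, mem_image, Finset.mem_coe] at hx
      obtain ⟨σ, hσ, rfl⟩ := hx
      exact (hS σ hσ).2.1 (hf σ)
    · intro x hx y hy
      simp only [Finset.mem_image] at hx
      obtain ⟨σ, hσ, rfl⟩ := hx
      have h1 := (hS σ hσ).2.2 _ (hf σ)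
      rw [mem_ball, dist_eq_norm] at hy
      simp only [Set.mem_sdiff, mem_closedBall, dist_zero_right, not_le]
      constructor
      · linarith [norm_sub_norm_le y (f σ)]
      · have := norm_sub_norm_le (f σ) y
        rw [norm_sub_rev] at this
        linarith
  have hv := volume_real_ball_pos (d := d) hr
  rw [← le_div_iff₀ hv] at himg
  calc (S.card : ℝ) ≤ (2 ^ N : ℕ) * ((S.image f).card : ℝ) := by exact_mod_cast hcard
    _ ≤ (2 ^ N : ℕ) * (((α + r) ^ d - (α - C - r) ^ d) * volume.real (ball (0 : Pt d) 1) /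
          volume.real (ball (0 : Pt d) r)) := by gcongr
    _ = _ := by ring

theorem tendsto_shell_ratio (d : ℕ) (a b : ℝ) :
    Tendsto (fun α : ℝ => ((α + a) ^ d - (α - b) ^ d) / α ^ d) atTop (nhds 0) := by
  have h (c : ℝ) : Tendsto (fun α : ℝ => (1 + c * α⁻¹) ^ d) atTop (nhds 1) := by
    simpa using ((tendsto_inv_atTop_zero.const_mul c).const_add 1).pow d
  have h2 := (h a).sub (h (-b))
  rw [sub_self] at h2
  refine h2.congr' ?_
  filter_upwards [eventually_gt_atTop 0] with α hα
  rw [sub_div, ← div_pow, ← div_pow]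
  congr 2 <;> field_simp
  ring

/-! ### Comparison of densities -/

theorem density_le_of_error {d : ℕ} (F : DSimplex d → ℝ) (K L : Set (Finset (Pt d))) (g : ℝ → ℝ)
    (hg : Tendsto (fun α => g α / volume.real (closedBall (0 : Pt d) α)) atTop (nhds 0))
    (h : ∀ᶠ α in atTop, simplexSum F K (closedBall 0 α) ≤ simplexSum F L (closedBall 0 α) + g α) :
    density F K ≤ density F L := by
  refine le_of_forall_lt fun c hc => ?_
  -- The gap between two reals `x < y` below the right-hand density absorbs the error term; this
  -- also works when that density is infinite.
  obtain ⟨x, hcx, hx⟩ := EReal.lt_iff_exists_real_btwn.1 hc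
  obtain ⟨y, hxy, hy⟩ := EReal.lt_iff_exists_real_btwn.1 hx
  refine hcx.trans_le (le_liminf_of_le (by isBoundedDefault) ?_)
  have h1 := eventually_lt_of_lt_liminf hy
  have hxy' : (0 : ℝ) < y - x := sub_pos.2 (EReal.coe_lt_coe_iff.1 hxy)
  filter_upwards [h1, h, hg.eventually_lt_const hxy', eventually_gt_atTop 0] with α h1 h2 h3 h4
  have h1 := EReal.coe_lt_coe_iff.1 h1
  rw [EReal.coe_le_coe_iff]
  have hv : 0 ≤ volume.real (closedBall (0 : Pt d) α) := measureReal_nonneg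
  have := div_le_div_of_nonneg_right h2 hv
  rw [add_div] at this
  linarith

theorem density_le_of_shell {d : ℕ} {X : Set (Pt d)} {r : ℝ} (hr : 0 < r) (hX : IsSparse X r)
    (F : DSimplex d → ℝ) (K L : Set (Finset (Pt d))) {q C M : ℝ} (hM : 0 ≤ M) (hC : 0 ≤ C)
    (h : ∀ᶠ α in atTop, ∃ S : Finset (DSimplex d),
      (∀ σ ∈ S, σ.CircumradiusLE q ∧ σ.InShell X C α) ∧
      simplexSum F K (closedBall 0 α) ≤ simplexSum F L (closedBall 0 α) + M * S.card) :
    density F K ≤ density F L := by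
  obtain ⟨N, hN⟩ := hX.exists_card_shell_le hr q hC
  refine density_le_of_error F K L (fun α => M * (N * ((α + r) ^ d - (α - C - r) ^ d))) ?_ ?_
  · have := (tendsto_shell_ratio d r (C + r)).const_mul (M * N / volume.real (ball (0 : Pt d) 1))
    rw [mul_zero] at this
    refine this.congr' ?_
    filter_upwards [eventually_gt_atTop 0] with α hα
    rw [Measure.addHaar_real_closedBall _ _ hα.le]
    simp only [finrank_euclideanSpace, Fintype.card_fin]
    have := volume_real_ball_pos (d := d) one_pos
    field_simp
    ring_nf
  · filter_upwards [h, eventually_ge_atTop (C + r)] with α ⟨S, hS, hle⟩ hα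
    exact hle.trans (by gcongr; exact hN α S hα hS)

theorem sum_sub_sum_le_card_symmDiff {ι : Type*} [DecidableEq ι] (A B : Finset ι) (F : ι → ℝ)
    (M : ℝ) (hA : ∀ i ∈ A \ B, |F i| ≤ M) (hB : ∀ i ∈ B \ A, |F i| ≤ M) :
    ∑ i ∈ A, F i ≤ ∑ i ∈ B, F i + M * (symmDiff A B).card := by
  have h1 : ∑ i ∈ A \ B, F i ≤ (A \ B).card • M :=
    Finset.sum_le_card_nsmul _ _ _ fun i hi => (abs_le.1 (hA i hi)).2
  have h2 : (B \ A).card • (-M) ≤ ∑ i ∈ B \ A, F i :=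
    Finset.card_nsmul_le_sum _ _ _ fun i hi => (abs_le.1 (hB i hi)).1
  have h3 := Finset.sum_sdiff_sub_sum_sdiff (s₁ := B) (s₂ := A) (f := F)
  have h4 : (symmDiff A B).card = (A \ B).card + (B \ A).card :=
    Finset.card_union_of_disjoint (by
      rw [Finset.disjoint_left]; intro x hx hy
      exact (Finset.mem_sdiff.1 hx).2 (Finset.mem_sdiff.1 hy).1)
  rw [h4]
  push_cast
  simp only [nsmul_eq_mul] at h1 h2
  linarith

theorem ClassE.exists_bound {d : ℕ} {F : DSimplex d → ℝ} (hF : F ∈ ClassE d) {X : Set (Pt d)}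
    {r q : ℝ} (hr : 0 < r) (hX : IsSparse X r) (hq : 0 < q) : ∃ M : ℝ, 0 ≤ M ∧
      ∀ σ : DSimplex d, (σ.verts : Set (Pt d)) ⊆ X → σ.CircumradiusLE q → |F σ| ≤ M := by
  obtain ⟨e, E, h⟩ := hF r q hr hq
  refine ⟨max |e| |E|, (abs_nonneg e).trans (le_max_left _ _), fun σ hσ hq => ?_⟩
  obtain ⟨h1, h2⟩ := h σ (fun x hx y hy => hX x (hσ hx) y (hσ hy)) hq
  exact abs_le_max_abs_abs h1 h2

/-! ### The `d`-simplices of a triangulation cover the space -/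

theorem volume_convexHull_eq_zero {d : ℕ} (s : Finset (Pt d)) (hs : s.card ≤ d) :
    volume (convexHull ℝ (s : Set (Pt d))) = 0 := by
  refine measure_mono_null (convexHull_subset_affineSpan _)
    (Measure.addHaar_affineSubspace _ _ fun htop => ?_)
  rcases s.eq_empty_or_nonempty with rfl | hne
  · simp at htop
  · have hv : vectorSpan ℝ (s : Set (Pt d)) = ⊤ := by
      rw [← direction_affineSpan, htop, AffineSubspace.direction_top]
    obtain ⟨n, hn⟩ : ∃ n, s.card = n + 1 := ⟨s.card - 1, by have := hne.card_pos; omega⟩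
    have h := finrank_vectorSpan_image_finset_le ℝ (id : Pt d → Pt d) s hn
    rw [Finset.image_id, hv, finrank_top] at h
    simp only [finrank_euclideanSpace, Fintype.card_fin] at h
    omega


theorem finite_faces_in_closedBall {d : ℕ} {X : Set (Pt d)} {r : ℝ} (hr : 0 < r)
    (hX : IsSparse X r) (K : Set (Finset (Pt d))) (hK : ∀ s ∈ K, (s : Set (Pt d)) ⊆ X)
    (z : Pt d) (α : ℝ) : {σ : DSimplex d | σ.verts ∈ K ∧ σ.body ⊆ closedBall z α}.Finite :=
  (finite_dSimplex_verts_subset (hX.finite_inter_closedBall hr z α)).subset fun σ hσ =>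
    subset_inter (hK _ hσ.1) (σ.verts_subset_body.trans hσ.2)

theorem simplexSum_eq_sum {d : ℕ} (F : DSimplex d → ℝ) (K : Set (Finset (Pt d))) (A : Set (Pt d))
    (S : Finset (DSimplex d)) (hS : ∀ σ, σ ∈ S ↔ σ.verts ∈ K ∧ σ.body ⊆ A) :
    simplexSum F K A = ∑ σ ∈ S, F σ := by
  have : {σ : DSimplex d | σ.verts ∈ K ∧ σ.body ⊆ A} = (S : Set (DSimplex d)) := by
    ext σ; simp [hS]
  rw [simplexSum, this, finsum_mem_coe_finset]

theorem faces_subset_vertices {d : ℕ} (T : Geometry.SimplicialComplex ℝ (Pt d))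
    {s : Finset (Pt d)} (hs : s ∈ T.faces) : (s : Set (Pt d)) ⊆ T.vertices := by
  rw [Geometry.SimplicialComplex.vertices_eq]
  exact subset_biUnion_of_mem (u := fun s : Finset (Pt d) => (s : Set (Pt d))) hs

/-- The union of the `d`-simplices is closed, because bounded diameter and sparse vertices make the
family locally finite. Its complement is open and covered by countably many faces of lower
dimension, hence null, hence empty. -/
theorem exists_dSimplex_of_mem_space {d : ℕ} {T : Geometry.SimplicialComplex ℝ (Pt d)} {r q : ℝ}
    (hr : 0 < r) (hX : IsSparse T.vertices r) (hT : T.space = univ)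
    (hq : ∀ σ : DSimplex d, σ.verts ∈ T.faces → σ.CircumradiusLE q) (p : Pt d) :
    ∃ σ : DSimplex d, σ.verts ∈ T.faces ∧ p ∈ σ.body := by
  let f : {σ : DSimplex d // σ.verts ∈ T.faces} → Set (Pt d) := fun σ => σ.1.body
  have hclosed : IsClosed (⋃ σ, f σ) := by
    refine LocallyFinite.isClosed_iUnion (fun z => ⟨closedBall z 1, closedBall_mem_nhds z one_pos,
      ?_⟩) (fun σ => σ.1.isCompact_body.isClosed)
    refine Set.Finite.of_injOn (f := Subtype.val) (t := {σ : DSimplex d |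
      (σ.verts : Set (Pt d)) ⊆ T.vertices ∩ closedBall z (1 + 2 * q)}) ?_
      Subtype.val_injective.injOn
      (finite_dSimplex_verts_subset (hX.finite_inter_closedBall hr z _))
    rintro ⟨σ, hσ⟩ ⟨y, hy, hyz⟩ x hx
    refine ⟨faces_subset_vertices T hσ hx, ?_⟩
    have h1 := (hq σ hσ).dist_le (σ.verts_subset_body hx) hy
    rw [mem_closedBall] at hyz ⊢
    linarith [dist_triangle x y z]
  have hcount : T.faces.Countable := by
    refine ((Set.countable_ofPred_finite_subset (hX.countable hr)).preimage
      Finset.coe_injective).mono fun s hs => ?_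
    exact ⟨s.finite_toSet, faces_subset_vertices T hs⟩
  have hnull : volume (⋃ σ, f σ)ᶜ = 0 := by
    refine measure_mono_null (t := ⋃ s ∈ {s ∈ T.faces | s.card ≤ d}, convexHull ℝ (s : Set (Pt d)))
      (fun x hx => ?_) ((measure_biUnion_null_iff (hcount.mono (sep_subset _ _))).2 fun s hs =>
        volume_convexHull_eq_zero s hs.2)
    obtain ⟨s, hs, hxs⟩ := Geometry.SimplicialComplex.mem_space_iff.1 (hT ▸ mem_univ x)
    refine mem_biUnion (x := s) ⟨hs, ?_⟩ hxs
    by_contra! hlt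
    have hind := T.indep hs
    have hcard : s.card = d + 1 := by
      have := hind.card_le_finrank_succ
      have h2 := Submodule.finrank_le (vectorSpan ℝ (Set.range ((↑) : s → Pt d)))
      simp only [Fintype.card_coe, finrank_euclideanSpace, Fintype.card_fin] at this h2
      omega
    exact hx (mem_iUnion.2 ⟨⟨⟨s, hcard, hind⟩, hs⟩, hxs⟩)
  have hempty := (hclosed.isOpen_compl.measure_eq_zero_iff volume).1 hnull
  rw [compl_empty_iff] at hempty
  obtain ⟨⟨σ, hσ⟩, hp⟩ := mem_iUnion.1 (hempty ▸ mem_univ p)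
  exact ⟨σ, hσ, hp⟩

theorem mem_verts_of_mem_body {d : ℕ} {T : Geometry.SimplicialComplex ℝ (Pt d)} {x : Pt d}
    {σ : DSimplex d} (hσ : σ.verts ∈ T.faces) (hx : x ∈ T.vertices) (hb : x ∈ σ.body) :
    x ∈ σ.verts :=
  (Geometry.SimplicialComplex.vertex_mem_convexHull_iff hx hσ).1 hb

/-! ### The theorem for the class `ClassG` -/

/-- The subcomplex of `T` of the faces in the ball of radius `α`, together with the vertices in the
ball of radius `β`. -/
def ballSubcomplex {d : ℕ} (T : Geometry.SimplicialComplex ℝ (Pt d)) (α β : ℝ) :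
    Geometry.SimplicialComplex ℝ (Pt d) where
  faces := {t | t ∈ T.faces ∧ ((t : Set (Pt d)) ⊆ closedBall 0 α ∨
    t.card = 1 ∧ (t : Set (Pt d)) ⊆ closedBall 0 β)}
  indep hs := T.indep hs.1
  isRelLowerSet_faces := by
    intro s hs
    refine ⟨T.nonempty_of_mem_faces hs.1, fun t hts ht => ⟨T.down_closed hs.1 hts ht, ?_⟩⟩
    have hts' : (t : Set (Pt d)) ⊆ s := Finset.coe_subset.2 hts
    rcases hs.2 with h | ⟨h1, h2⟩
    · exact Or.inl (hts'.trans h)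
    · refine Or.inr ⟨le_antisymm (h1 ▸ Finset.card_le_card hts) ht.card_pos, hts'.trans h2⟩
  inter_subset_convexHull hs ht := T.inter_subset_convexHull hs.1 ht.1

theorem vertices_ballSubcomplex {d : ℕ} (T : Geometry.SimplicialComplex ℝ (Pt d)) {α β : ℝ}
    (h : α ≤ β) : (ballSubcomplex T α β).vertices = T.vertices ∩ closedBall 0 β := by
  ext x
  simp only [ballSubcomplex, Geometry.SimplicialComplex.vertices, mem_ofPred_eq, mem_inter_iff,
    Finset.coe_singleton, singleton_subset_iff, Finset.card_singleton, true_and]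
  refine and_congr_right fun _ => ⟨fun hx => ?_, Or.inr⟩
  exact hx.elim (fun h' => closedBall_subset_closedBall h h') id

/-- Every point of the simplex is a limit of points on a segment towards another vertex, and these
avoid the finite set. This discards the isolated vertices in the space of `ballSubcomplex`; for `d =
0` there is no second vertex. -/
theorem DSimplex.subset_of_body_subset_union_finite {d : ℕ} (σ : DSimplex d) {A B : Set (Pt d)}
    (hd : d ≠ 0) (hA : IsClosed A) (hB : B.Finite) (h : σ.body ⊆ A ∪ B) : σ.body ⊆ A := by
  have hconv : Convex ℝ σ.body := convex_convexHull ℝ _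
  intro v hv
  obtain ⟨w, hw, hwv⟩ : ∃ w ∈ σ.verts, w ≠ v :=
    Finset.exists_mem_ne (by rw [σ.card_verts]; omega) v
  have htend : Tendsto (fun t : ℝ => AffineMap.lineMap v w t) (nhdsWithin 0 (Ioo 0 1))
      (nhds v) := by
    have : Continuous fun t : ℝ => AffineMap.lineMap v w t := AffineMap.lineMap_continuous
    simpa using (this.tendsto 0).mono_left (nhdsWithin_le_nhds (s := Ioo (0 : ℝ) 1))
  have hne : (nhdsWithin (0 : ℝ) (Ioo 0 1)).NeBot := by
    rw [nhdsWithin_Ioo_eq_nhdsGT one_pos]; infer_instance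
  have hinj : Function.Injective fun t : ℝ => AffineMap.lineMap v w t :=
    AffineMap.lineMap_injective ℝ hwv.symm
  have hfin := hB.preimage hinj.injOn
  refine hA.mem_of_tendsto htend ?_
  have hev : ∀ᶠ t : ℝ in nhdsWithin 0 (Ioo 0 1),
      t ∉ (fun t : ℝ => AffineMap.lineMap v w t) ⁻¹' B \ {0} :=
    nhdsWithin_le_nhds ((hfin.sdiff (t := {0})).isClosed.isOpen_compl.mem_nhds (by simp))
  filter_upwards [hev, self_mem_nhdsWithin] with t ht ht01
  refine (h ?_).resolve_right fun hB => ht ⟨hB, ht01.1.ne'⟩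
  exact hconv.segment_subset hv (σ.verts_subset_body hw)
    (by rw [segment_eq_image_lineMap]; exact ⟨t, ⟨ht01.1.le, ht01.2.le⟩, rfl⟩)

/-- Once the circumradius is known to be at most `R`, the circumball stays within `2 * R` of a
vertex, where truncation removes no points. A larger empty ball would contain, near that vertex, a
ball of radius `R` and hence a point of the truncated set. -/
theorem DSimplex.IsEmptyIn.of_inter_closedBall {d : ℕ} {X : Set (Pt d)} {R α : ℝ} (hR : 0 < R)
    (hXR : ∀ z : Pt d, (X ∩ closedBall z R).Nonempty) {σ : DSimplex d}
    (h : σ.IsEmptyIn (X ∩ closedBall 0 (α + (2 * R + 1))))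
    (hα : (σ.verts : Set (Pt d)) ⊆ closedBall 0 α) : σ.IsEmptyIn X := by
  obtain ⟨hv, c, ρ, hc, he⟩ := h
  obtain ⟨v, hvσ⟩ := σ.nonempty_verts
  have hvα := mem_closedBall_zero_iff.1 (hα hvσ)
  have hvc := hc v hvσ
  have hρ : ρ ≤ R := by
    by_contra! hlt
    have hρ0 : 0 < ρ := hR.trans hlt
    -- The ball of radius `R` is centered at distance `s` from `v` towards `c`. The bound `s > R`
    -- places it in the open circumball, and `s ≤ R + 1` keeps it within `2 * R + 1` of `v`.
    set s := min ρ (R + 1) with hs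
    have hsR : R < s := lt_min hlt (by linarith)
    have hsρ : s ≤ ρ := min_le_left _ _
    have hs1 : s ≤ R + 1 := min_le_right _ _
    obtain ⟨x, hx, hxz⟩ := hXR (AffineMap.lineMap v c (s / ρ))
    rw [mem_closedBall] at hxz
    have h1 : dist (AffineMap.lineMap v c (s / ρ)) v = s := by
      rw [dist_lineMap_left, hvc, Real.norm_of_nonneg (by positivity), div_mul_cancel₀ _ hρ0.ne']
    have h2 : dist (AffineMap.lineMap v c (s / ρ)) c = ρ - s := by
      rw [dist_lineMap_right, hvc, Real.norm_of_nonneg (sub_nonneg.2 ((div_le_one hρ0).2 hsρ)),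
        sub_mul, div_mul_cancel₀ _ hρ0.ne', one_mul]
    refine (he.subset ⟨⟨hx, ?_⟩, ?_⟩ : x ∈ (∅ : Set (Pt d)))
    · rw [mem_closedBall_zero_iff]
      have := dist_triangle x (AffineMap.lineMap v c (s / ρ)) v
      rw [dist_eq_norm x v] at this
      linarith [norm_sub_norm_le x v]
    · rw [mem_ball]
      linarith [dist_triangle x (AffineMap.lineMap v c (s / ρ)) c]
  refine ⟨fun x hx => (hv hx).1, c, ρ, hc, ?_⟩
  rw [eq_empty_iff_forall_notMem] at he ⊢
  rintro x ⟨hx, hxc⟩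
  refine he x ⟨⟨hx, ?_⟩, hxc⟩
  rw [mem_ball] at hxc
  rw [mem_closedBall_zero_iff]
  have := dist_triangle_right x v c
  rw [dist_eq_norm x v] at this
  linarith [norm_sub_norm_le x v]

theorem IsGeneric.mono {d : ℕ} {X Y : Set (Pt d)} (hX : IsGeneric X) (h : Y ⊆ X) : IsGeneric Y :=
  fun s hs => hX s (hs.trans h)

/-- This covers `d = 0`, the only dimension in which an isolated vertex of `ballSubcomplex` is
itself a `d`-simplex. -/
theorem DSimplex.card_verts_eq_one_subset {d : ℕ} (σ : DSimplex d) (h : σ.verts.card = 1) {α : ℝ}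
    (hα : 0 ≤ α) : (σ.verts : Set (Pt d)) ⊆ closedBall 0 α := by
  rw [σ.card_verts] at h
  obtain rfl : d = 0 := by omega
  intro x _
  rw [Subsingleton.elim x 0]
  exact mem_closedBall_self hα

theorem density_delaunay_le_of_mem_classG {d : ℕ} {X : Set (Pt d)} (hX : IsDelaunaySet X)
    (hgen : IsGeneric X) {F : DSimplex d → ℝ} (hF : F ∈ ClassG d)
    {T : Geometry.SimplicialComplex ℝ (Pt d)} (hT : IsTriangulation T X)
    (hTq : IsUniformlyBounded T) : density F (delaunay X) ≤ density F T.faces := by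
  classical
  obtain ⟨r, R, hr, hrR, hXr, hXR⟩ := hX
  have hsp := isSparse_of_subsingleton_inter_ball hXr
  obtain ⟨q, hq⟩ := hTq
  have hR : 0 < R := hr.trans hrR
  obtain ⟨M, hM, hFM⟩ := ClassE.exists_bound hF.1 hr hsp hR
  obtain ⟨rfl, hTs⟩ := hT
  -- The term `2 * R` bounds the diameter of a Delaunay simplex and `2 * max q 0` that of a simplex
  -- of `T`; `q` has no known sign.
  refine density_le_of_shell hr hsp F _ _ (q := R) (C := 2 * R + 2 * max q 0) hM
    (by positivity) ?_
  filter_upwards [eventually_ge_atTop 0] with α hα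
  set T' := ballSubcomplex T α (α + (2 * R + 1)) with hT'
  have hv := vertices_ballSubcomplex T (α := α) (β := α + (2 * R + 1)) (by linarith)
  rw [← hT'] at hv
  have hYfin := hsp.finite_inter_closedBall hr 0 (α + (2 * R + 1))
  have hY : T'.vertices = (hYfin.toFinset : Set (Pt d)) := by rw [hv, Finite.coe_toFinset]
  have hkey := hF.2 hYfin.toFinset (hgen.mono (by simp)) T' hY
  rw [Finite.coe_toFinset] at hkey
  have hfinD := finite_faces_in_closedBall hr hsp (delaunay T.vertices)
    (fun s hs => by
      obtain ⟨_, σ, hσ, hsσ⟩ := hs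
      exact (Finset.coe_subset.2 hsσ).trans hσ.1) 0 α
  have hfinT := finite_faces_in_closedBall hr hsp T.faces (fun s => faces_subset_vertices T) 0 α
  have hspace : T'.space ⊆ closedBall 0 α ∪ hYfin.toFinset := by
    intro x hx
    obtain ⟨s, ⟨hs, hs' | ⟨hs1, hs2⟩⟩, hxs⟩ := Geometry.SimplicialComplex.mem_space_iff.1 hx
    · exact Or.inl (convexHull_min hs' (convex_closedBall _ _) hxs)
    · obtain ⟨y, rfl⟩ := Finset.card_eq_one.1 hs1
      rw [Finset.coe_singleton, convexHull_singleton, mem_singleton_iff] at hxs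
      subst hxs
      refine Or.inr ?_
      rw [Finite.coe_toFinset]
      exact ⟨hs, hs2 (by simp)⟩
  have hE : ∀ σ : DSimplex d, σ.verts ∈ delaunay (T.vertices ∩ closedBall 0 (α + (2 * R + 1))) ∧
      σ.body ⊆ T'.space ↔ (σ.verts ∈ delaunay T.vertices ∧ σ.body ⊆ closedBall 0 α) ∧
      σ.body ⊆ T'.space := by
    intro σ
    rw [DSimplex.verts_mem_delaunay, DSimplex.verts_mem_delaunay]
    constructor
    · rintro ⟨h1, h2⟩
      have h3 : σ.body ⊆ closedBall 0 α := by
        rcases eq_or_ne d 0 with hd | hd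
        · exact (σ.body_subset_iff (convex_closedBall _ _)).2
            (σ.card_verts_eq_one_subset (by rw [σ.card_verts, hd]) hα)
        · exact σ.subset_of_body_subset_union_finite hd isClosed_closedBall
            (Finset.finite_toSet _) (h2.trans hspace)
      exact ⟨⟨h1.of_inter_closedBall hR hXR (σ.verts_subset_body.trans h3), h3⟩, h2⟩
    · rintro ⟨⟨⟨h1, c, ρ, hc, he⟩, h3⟩, h2⟩
      refine ⟨⟨subset_inter h1 ((σ.verts_subset_body.trans h3).trans
        (closedBall_subset_closedBall (by linarith))), c, ρ, hc, ?_⟩, h2⟩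
      exact subset_eq_empty (inter_subset_inter_left _ inter_subset_left) he
  set D := hfinD.toFinset with hD
  set E := D.filter fun σ => σ.body ⊆ T'.space with hEdef
  have hsumD : simplexSum F (delaunay T.vertices) (closedBall 0 α) = ∑ σ ∈ D, F σ :=
    simplexSum_eq_sum _ _ _ _ fun σ => by simp [hD]
  have hsumE : simplexSum F (delaunay (T.vertices ∩ closedBall 0 (α + (2 * R + 1)))) T'.space =
      ∑ σ ∈ E, F σ := simplexSum_eq_sum _ _ _ _ fun σ => by
    rw [hE, hEdef, Finset.mem_filter, hD, Finite.mem_toFinset]; rfl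
  have hsumT : simplexSum F T'.faces univ = simplexSum F T.faces (closedBall 0 α) := by
    rw [simplexSum_eq_sum F T.faces (closedBall 0 α) hfinT.toFinset (by simp)]
    refine simplexSum_eq_sum _ _ _ _ fun σ => ?_
    simp only [Finite.mem_toFinset, mem_ofPred_eq, subset_univ, and_true,
      σ.body_subset_iff (convex_closedBall (0 : Pt d) α)]
    refine ⟨fun h => ⟨h.1, Or.inl h.2⟩, fun h => ⟨h.1, h.2.elim id fun h' => ?_⟩⟩
    exact σ.card_verts_eq_one_subset h'.1 hα
  have hEmem : ∀ σ ∈ D, σ.IsEmptyIn T.vertices := fun σ hσ =>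
    DSimplex.verts_mem_delaunay.1 (hfinD.mem_toFinset.1 hσ).1
  have hED : E \ D = ∅ := Finset.sdiff_eq_empty_iff_subset.2 (Finset.filter_subset _ _)
  refine ⟨symmDiff D E, fun σ hσ => ?_, ?_⟩
  · rw [Finset.mem_symmDiff] at hσ
    have hσ' : σ ∈ D ∧ σ ∉ E := hσ.resolve_right fun h => h.2 (Finset.mem_filter.1 h.1).1
    obtain ⟨hσD, hσE⟩ := hσ'
    have hem := hEmem σ hσD
    have hcr := hem.circumradiusLE hXR
    have hbody := (hfinD.mem_toFinset.1 hσD).2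
    refine ⟨hcr, hem.1, fun x hx => ⟨mem_closedBall_zero_iff.1 (hbody (σ.verts_subset_body hx)),
      ?_⟩⟩
    -- If some vertex is deeper than the shell, every point of `σ` lies in a `d`-simplex of `T`
    -- contained in the ball, so `σ` is covered by `T'`.
    by_contra! hle
    refine hσE (Finset.mem_filter.2 ⟨hσD, fun y hy => ?_⟩)
    obtain ⟨τ, hτ, hyτ⟩ := exists_dSimplex_of_mem_space hr hsp hTs hq y
    refine Geometry.SimplicialComplex.mem_space_iff.2 ⟨τ.verts, ⟨hτ, Or.inl fun z hz => ?_⟩, hyτ⟩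
    rw [mem_closedBall_zero_iff]
    have h1 := hcr.dist_le hy (σ.verts_subset_body hx)
    have h2 := (hq τ hτ).dist_le (τ.verts_subset_body hz) hyτ
    rw [dist_eq_norm] at h1 h2
    linarith [norm_sub_norm_le y x, norm_sub_norm_le z y, le_max_left q 0]
  · rw [hsumD]
    refine (sum_sub_sum_le_card_symmDiff D E F M (fun σ hσ => ?_) (by simp [hED])).trans ?_
    · have hem := hEmem σ (Finset.mem_sdiff.1 hσ).1
      exact hFM σ hem.1 (hem.circumradiusLE hXR)
    · linarith

/-! ### Barycentric coordinates -/

theorem DSimplex.weights_eq_zero {d : ℕ} (σ : DSimplex d) {w : Pt d → ℝ}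
    (h0 : ∑ y ∈ σ.verts, w y = 0) (h1 : ∑ y ∈ σ.verts, w y • y = 0) :
    ∀ y ∈ σ.verts, w y = 0 := by
  intro y hy
  refine affineIndependent_iff.1 σ.2.2 Finset.univ (fun e => w e) ?_ ?_ ⟨y, hy⟩
    (Finset.mem_univ _)
  · rw [← h0]; exact Finset.sum_coe_sort σ.verts w
  · rw [← h1]; exact Finset.sum_coe_sort σ.verts fun y => w y • y

theorem DSimplex.exists_weights {d : ℕ} (σ : DSimplex d) (p : Pt d) :
    ∃ w : Pt d → ℝ, ∑ y ∈ σ.verts, w y = 1 ∧ ∑ y ∈ σ.verts, w y • y = p := by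
  classical
  have htop : affineSpan ℝ (Set.range ((↑) : σ.verts → Pt d)) = ⊤ := by
    refine (σ.2.2.affineSpan_eq_top_iff_card_eq_finrank_add_one).2 ?_
    rw [finrank_euclideanSpace, Fintype.card_fin, Fintype.card_coe]
    exact σ.2.1
  obtain ⟨w, hw, hp⟩ := eq_affineCombination_of_mem_affineSpan_of_fintype
    (htop ▸ AffineSubspace.mem_top ℝ _ p)
  rw [Finset.affineCombination_eq_linear_combination _ _ _ hw] at hp
  refine ⟨fun y => if h : y ∈ σ.verts then w ⟨y, h⟩ else 0, ?_, ?_⟩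
  · rw [← hw, ← Finset.sum_coe_sort]; simp
  · rw [hp, ← Finset.sum_coe_sort]; simp

theorem DSimplex.exists_isCircumsphere {d : ℕ} (σ : DSimplex d) : ∃ c ρ, σ.IsCircumsphere c ρ := by
  have : Nonempty σ.verts := σ.nonempty_verts.to_subtype
  obtain ⟨S, ⟨-, hS⟩, -⟩ := σ.2.2.existsUnique_dist_eq (ι := σ.verts)
  exact ⟨S.center, S.radius, fun x hx => hS ⟨⟨x, hx⟩, rfl⟩⟩

/-- The difference of the squared distances to two fixed centers is an affine function of the point,
so it commutes with affine combinations. -/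
theorem sum_weights_sq_dist {ι : Type*} {d : ℕ} (s : Finset ι) (w : ι → ℝ) (v : ι → Pt d)
    (p c c' : Pt d) (h1 : ∑ i ∈ s, w i = 1) (hp : ∑ i ∈ s, w i • v i = p) :
    ∑ i ∈ s, w i * (dist (v i) c ^ 2 - dist (v i) c' ^ 2) = dist p c ^ 2 - dist p c' ^ 2 := by
  have h (x : Pt d) : dist x c ^ 2 - dist x c' ^ 2 =
      inner ℝ x ((2 : ℝ) • (c' - c)) + (‖c‖ ^ 2 - ‖c'‖ ^ 2) := by
    rw [dist_eq_norm, dist_eq_norm, norm_sub_sq_real, norm_sub_sq_real, inner_smul_right,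
      inner_sub_right]
    ring
  simp only [h, mul_add, Finset.sum_add_distrib, ← Finset.sum_mul, h1, one_mul, ← hp, sum_inner,
    real_inner_smul_left]

theorem sum_weights_sq_dist_triple {d : ℕ} {a b e p : Pt d} {x y z : ℝ} (c c' : Pt d)
    (h1 : x + y + z = 1) (hp : x • a + y • b + z • e = p) :
    x * (dist a c ^ 2 - dist a c' ^ 2) + y * (dist b c ^ 2 - dist b c' ^ 2) +
      z * (dist e c ^ 2 - dist e c' ^ 2) = dist p c ^ 2 - dist p c' ^ 2 := by
  have := sum_weights_sq_dist Finset.univ ![x, y, z] ![a, b, e] p c c'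
    (by simp [Fin.sum_univ_three, h1]) (by simp [Fin.sum_univ_three, hp])
  simpa [Fin.sum_univ_three] using this

theorem DSimplex.mem_of_mem_convexHull {d : ℕ} (σ : DSimplex d) {t : Set (Pt d)}
    (ht : t ⊆ σ.verts) {w : Pt d → ℝ} (h1 : ∑ y ∈ σ.verts, w y = 1)
    (hp : ∑ y ∈ σ.verts, w y • y ∈ convexHull ℝ t) {a : Pt d} (ha : a ∈ σ.verts) (hwa : w a ≠ 0) :
    a ∈ t := by
  classical
  obtain ⟨t, rfl⟩ : ∃ t' : Finset (Pt d), (t' : Set (Pt d)) = t :=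
    ⟨(σ.verts.finite_toSet.subset ht).toFinset, Finite.coe_toFinset _⟩
  obtain ⟨u, -, hu1, hu⟩ := Finset.mem_convexHull'.1 hp
  by_contra hat
  have hts : t ⊆ σ.verts := Finset.coe_subset.1 ht
  have := σ.weights_eq_zero (w := fun y => w y - if y ∈ t then u y else 0) ?_ ?_ a ha
  · rw [if_neg (by simpa using hat), sub_zero] at this
    exact hwa this
  · rw [Finset.sum_sub_distrib, h1, Finset.sum_ite_mem, Finset.inter_eq_right.2 hts, hu1, sub_self]
  · simp only [sub_smul, ite_smul, zero_smul]
    rw [Finset.sum_sub_distrib, Finset.sum_ite_mem, Finset.inter_eq_right.2 hts, hu, sub_self]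

/-- Two empty simplices of a generic set coincide if they share an interior point of one. -/
theorem DSimplex.IsEmptyIn.eq_of_mem_body {d : ℕ} {X : Set (Pt d)} (hgen : IsGeneric X)
    {σ τ : DSimplex d} (hσ : σ.IsEmptyIn X) (hτ : τ.IsEmptyIn X) {w : Pt d → ℝ}
    (hw : ∀ y ∈ σ.verts, 0 < w y) (h1 : ∑ y ∈ σ.verts, w y = 1)
    (hp : ∑ y ∈ σ.verts, w y • y ∈ τ.body) : σ = τ := by
  classical
  obtain ⟨hσX, c, ρ, hc, hce⟩ := hσ
  obtain ⟨hτX, c', ρ', hc', hce'⟩ := hτ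
  set p := ∑ y ∈ σ.verts, w y • y with hpdef
  obtain ⟨u, hu0, hu1, hu⟩ := Finset.mem_convexHull'.1 hp
  have hout {e : Pt d} {s : ℝ} (hs : 0 ≤ s) (he : X ∩ ball e s = ∅) {x : Pt d} (hx : x ∈ X) :
      s ^ 2 ≤ dist x e ^ 2 := by
    refine pow_le_pow_left₀ hs ?_ 2
    by_contra! hlt
    exact (he.subset ⟨hx, hlt⟩ : x ∈ (∅ : Set (Pt d)))
  -- The affine function `dist x c ^ 2 - dist x c' ^ 2` is at most `ρ ^ 2 - ρ' ^ 2` on the vertices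
  -- of `σ` and at least that on those of `τ`. Both triples of bounds meet at `p`, and the positive
  -- weights force equality at each vertex of `σ`, which thus lies on the sphere of `τ`. If `σ ≠ τ`,
  -- this sphere carries at least `d + 2` points.
  have e1 := sum_weights_sq_dist σ.verts w id p c c' h1 rfl
  have e2 := sum_weights_sq_dist τ.verts u id p c c' hu1 hu
  have g1 : ∀ y ∈ σ.verts, w y * (dist y c ^ 2 - dist y c' ^ 2) ≤ w y * (ρ ^ 2 - ρ' ^ 2) := by
    intro y hy
    refine mul_le_mul_of_nonneg_left ?_ (hw y hy).le
    rw [hc y hy]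
    linarith [hout hc'.nonneg hce' (hσX hy)]
  have g2 : ∀ y ∈ τ.verts, u y * (ρ ^ 2 - ρ' ^ 2) ≤ u y * (dist y c ^ 2 - dist y c' ^ 2) := by
    intro y hy
    refine mul_le_mul_of_nonneg_left ?_ (hu0 y hy)
    rw [hc' y hy]
    linarith [hout hc.nonneg hce (hτX hy)]
  have s2 := Finset.sum_le_sum g2
  rw [← Finset.sum_mul, hu1, one_mul] at s2
  simp only [id] at e1 e2
  have hle := Finset.sum_le_sum g1
  have heq : ∑ y ∈ σ.verts, w y * (dist y c ^ 2 - dist y c' ^ 2) =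
      ∑ y ∈ σ.verts, w y * (ρ ^ 2 - ρ' ^ 2) := by
    refine le_antisymm hle ?_
    rw [← Finset.sum_mul, h1, one_mul, e1, ← e2]
    exact s2
  have hall := (Finset.sum_eq_sum_iff_of_le g1).1 heq
  have hcos : ∀ y ∈ σ.verts, dist y c' = ρ' := by
    intro y hy
    have h3 := mul_left_cancel₀ (hw y hy).ne' (hall y hy)
    rw [hc y hy] at h3
    exact (pow_left_inj₀ dist_nonneg hc'.nonneg two_ne_zero).1 (by linarith)
  by_contra hne
  have hcard : d + 2 ≤ (σ.verts ∪ τ.verts).card := by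
    by_contra! hlt
    have h4 := Finset.eq_of_subset_of_card_le (Finset.subset_union_left (s₁ := σ.verts)
      (s₂ := τ.verts)) (by rw [σ.card_verts]; omega)
    exact hne (DSimplex.eq_of_subset (h4 ▸ Finset.subset_union_right)).symm
  obtain ⟨s, hs, hsc⟩ := Finset.exists_subset_card_eq hcard
  refine hgen s (fun x hx => ?_) hsc ⟨c', ρ', fun x hx => ?_⟩
  · exact (Finset.mem_union.1 (hs hx)).elim (fun h => hσX h) (fun h => hτX h)
  · exact (Finset.mem_union.1 (hs hx)).elim (hcos x) (hc' x)

/-! ### Triangles -/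

/-- No nontrivial affine relation holds between `a`, `b` and `c`. -/
def Indep3 (a b c : Pt 2) : Prop :=
  ∀ x y z : ℝ, x + y + z = 0 → x • a + y • b + z • c = 0 → x = 0 ∧ y = 0 ∧ z = 0

theorem Indep3.swap {a b c : Pt 2} (h : Indep3 a b c) : Indep3 b a c := fun x y z h1 h2 => by
  obtain ⟨h3, h4, h5⟩ := h y x z (by linarith) (by rw [← h2]; module)
  exact ⟨h4, h3, h5⟩

theorem Indep3.rotate {a b c : Pt 2} (h : Indep3 a b c) : Indep3 b c a := fun x y z h1 h2 => by
  obtain ⟨h3, h4, h5⟩ := h z x y (by linarith) (by rw [← h2]; module)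
  exact ⟨h4, h5, h3⟩

theorem Indep3.ne {a b c : Pt 2} (h : Indep3 a b c) : a ≠ b := by
  rintro rfl
  simpa using (h 1 (-1) 0 (by norm_num) (by module)).1

theorem Indep3.ne_all {a b c : Pt 2} (h : Indep3 a b c) : a ≠ b ∧ b ≠ c ∧ a ≠ c :=
  ⟨h.ne, h.rotate.ne, h.rotate.rotate.ne.symm⟩

theorem exists_weight_triple {a b c : Pt 2} (hab : a ≠ b) (hbc : b ≠ c) (hac : a ≠ c) (x y z : ℝ) :
    ∃ w : Pt 2 → ℝ, w a = x ∧ w b = y ∧ w c = z := by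
  classical
  refine ⟨fun e => if e = a then x else if e = b then y else z, ?_, ?_, ?_⟩
  · simp
  · simp [hab.symm]
  · simp [hac.symm, hbc.symm]

/-- The vertices of `σ` are `a`, `b` and `c`. -/
def DSimplex.IsTriangle (σ : DSimplex 2) (a b c : Pt 2) : Prop :=
  (σ.verts : Set (Pt 2)) = {a, b, c}

namespace DSimplex.IsTriangle

variable {σ τ : DSimplex 2} {a b c : Pt 2}

theorem mem_iff (h : σ.IsTriangle a b c) {x : Pt 2} : x ∈ σ.verts ↔ x = a ∨ x = b ∨ x = c := by
  rw [← Finset.mem_coe, h]; simp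

theorem swap (h : σ.IsTriangle a b c) : σ.IsTriangle b a c := by
  rw [IsTriangle, h, Set.insert_comm]

theorem rotate (h : σ.IsTriangle a b c) : σ.IsTriangle b c a := by
  rw [IsTriangle, h, Set.insert_comm, Set.pair_comm a c]

theorem mem1 (h : σ.IsTriangle a b c) : a ∈ σ.verts := h.mem_iff.2 (Or.inl rfl)
theorem mem2 (h : σ.IsTriangle a b c) : b ∈ σ.verts := h.rotate.mem1
theorem mem3 (h : σ.IsTriangle a b c) : c ∈ σ.verts := h.rotate.rotate.mem1

theorem eq (hσ : σ.IsTriangle a b c) (hτ : τ.IsTriangle a b c) : σ = τ :=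
  DSimplex.ext (Finset.coe_injective (hσ.trans hτ.symm))

theorem ne (h : σ.IsTriangle a b c) : a ≠ b := by
  classical
  rintro rfl
  have h1 : σ.verts = {a, c} := Finset.coe_injective (by rw [h]; simp)
  have := σ.card_verts
  rw [h1] at this
  have := Finset.card_le_two (a := a) (b := c)
  omega

theorem sum_eq {M : Type*} [AddCommMonoid M] (h : σ.IsTriangle a b c) (f : Pt 2 → M) :
    ∑ y ∈ σ.verts, f y = f a + f b + f c := by
  classical
  have h1 : σ.verts = {a, b, c} := Finset.coe_injective (by rw [h]; simp)
  rw [h1, Finset.sum_insert (by simp [h.ne, h.rotate.rotate.ne.symm]), Finset.sum_pair h.rotate.ne,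
    add_assoc]

theorem exists_weight (h : σ.IsTriangle a b c) (x y z : ℝ) :
    ∃ w : Pt 2 → ℝ, w a = x ∧ w b = y ∧ w c = z :=
  exists_weight_triple h.ne h.rotate.ne h.rotate.rotate.ne.symm x y z

theorem indep3 (h : σ.IsTriangle a b c) : Indep3 a b c := by
  intro x y z h0 h1
  obtain ⟨w, rfl, rfl, rfl⟩ := h.exists_weight x y z
  have := σ.weights_eq_zero (w := w) (by rw [h.sum_eq, h0])
    (by rw [h.sum_eq fun y => w y • y, h1])
  exact ⟨this _ h.mem1, this _ h.mem2, this _ h.mem3⟩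

theorem exists_coords (h : σ.IsTriangle a b c) (p : Pt 2) :
    ∃ x y z : ℝ, x + y + z = 1 ∧ x • a + y • b + z • c = p := by
  obtain ⟨w, h1, h2⟩ := σ.exists_weights p
  rw [h.sum_eq] at h1
  rw [h.sum_eq fun y => w y • y] at h2
  exact ⟨_, _, _, h1, h2⟩

theorem coords_of_mem_convexHull (h : σ.IsTriangle a b c) {t : Set (Pt 2)} (ht : t ⊆ σ.verts)
    {x y z : ℝ} (h1 : x + y + z = 1) (hp : x • a + y • b + z • c ∈ convexHull ℝ t) :
    (x ≠ 0 → a ∈ t) ∧ (y ≠ 0 → b ∈ t) ∧ (z ≠ 0 → c ∈ t) := by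
  obtain ⟨w, rfl, rfl, rfl⟩ := h.exists_weight x y z
  rw [← h.sum_eq] at h1
  rw [← h.sum_eq fun y => w y • y] at hp
  exact ⟨σ.mem_of_mem_convexHull ht h1 hp h.mem1, σ.mem_of_mem_convexHull ht h1 hp h.mem2,
    σ.mem_of_mem_convexHull ht h1 hp h.mem3⟩

theorem mem_body_iff (h : σ.IsTriangle a b c) {p : Pt 2} : p ∈ σ.body ↔
    ∃ x y z : ℝ, 0 ≤ x ∧ 0 ≤ y ∧ 0 ≤ z ∧ x + y + z = 1 ∧ x • a + y • b + z • c = p := by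
  rw [DSimplex.body, Finset.mem_convexHull']
  constructor
  · rintro ⟨w, h0, h1, h2⟩
    rw [h.sum_eq] at h1
    rw [h.sum_eq fun y => w y • y] at h2
    exact ⟨_, _, _, h0 _ h.mem1, h0 _ h.mem2, h0 _ h.mem3, h1, h2⟩
  · rintro ⟨x, y, z, hx, hy, hz, h1, h2⟩
    obtain ⟨w, rfl, rfl, rfl⟩ := h.exists_weight x y z
    refine ⟨w, fun v hv => ?_, by rw [h.sum_eq, h1], by rw [h.sum_eq fun y => w y • y, h2]⟩
    rcases h.mem_iff.1 hv with rfl | rfl | rfl <;> assumption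

end DSimplex.IsTriangle

theorem exists_isTriangle {a b c : Pt 2} (h : Indep3 a b c) : ∃ σ : DSimplex 2,
    σ.IsTriangle a b c := by
  classical
  obtain ⟨hab, hbc, hac⟩ := h.ne_all
  have hc : (({a, b, c} : Finset (Pt 2)) : Set (Pt 2)) = {a, b, c} := by simp
  refine ⟨⟨{a, b, c}, Finset.card_eq_three.2 ⟨a, b, c, hab, hac, hbc, rfl⟩, ?_⟩, hc⟩
  have hi : AffineIndependent ℝ ![a, b, c] := by
    rw [affineIndependent_iff_of_fintype]
    intro w hw hv
    rw [Finset.univ.weightedVSub_eq_linear_combination hw] at hv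
    simp only [Fin.sum_univ_three, Matrix.cons_val_zero, Matrix.cons_val_one,
      Matrix.cons_val_two] at hw hv
    obtain ⟨h1, h2, h3⟩ := h _ _ _ hw hv
    intro i
    fin_cases i <;> assumption
  have hr : Set.range ![a, b, c] = (({a, b, c} : Finset (Pt 2)) : Set (Pt 2)) := by
    rw [hc]; ext x; simp [eq_comm]; tauto
  have hi' := hi.range
  rw [hr] at hi'
  exact hi'

theorem mem_convexHull_of_coords {a b c : Pt 2} {t : Set (Pt 2)} {x y z : ℝ} (hx : 0 ≤ x)
    (hy : 0 ≤ y) (hz : 0 ≤ z) (h1 : x + y + z = 1) (ha : x ≠ 0 → a ∈ t) (hb : y ≠ 0 → b ∈ t)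
    (hc : z ≠ 0 → c ∈ t) : x • a + y • b + z • c ∈ convexHull ℝ t := by
  obtain ⟨e, he⟩ : ∃ e, e ∈ t := by
    by_contra! hno
    have hx0 : x = 0 := by_contra fun h => hno _ (ha h)
    have hy0 : y = 0 := by_contra fun h => hno _ (hb h)
    have hz0 : z = 0 := by_contra fun h => hno _ (hc h)
    linarith
  -- A vertex of weight zero need not belong to `t` and may be replaced by `e`.
  have key : ∀ {s : ℝ} {v : Pt 2}, (s ≠ 0 → v ∈ t) → ∃ v' ∈ t, s • v' = s • v := by
    intro s v hv
    rcases eq_or_ne s 0 with rfl | hs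
    · exact ⟨e, he, by simp⟩
    · exact ⟨v, hv hs, rfl⟩
  obtain ⟨a', ha', hxa⟩ := key ha
  obtain ⟨b', hb', hyb⟩ := key hb
  obtain ⟨c', hc', hzc⟩ := key hc
  rw [← hxa, ← hyb, ← hzc]
  have := (convex_convexHull ℝ t).sum_mem (t := Finset.univ) (w := ![x, y, z]) (z := ![a', b', c'])
    (by intro i _; fin_cases i <;> assumption) (by simp [Fin.sum_univ_three, h1])
    (by intro i _; fin_cases i <;> (apply subset_convexHull; assumption))
  simpa [Fin.sum_univ_three] using this

/-! ### Convex quadrilaterals -/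

/-- The open segments `ac` and `bd` cross in the point `α a + γ c = β b + δ d`. -/
structure Crossing (a b c d : Pt 2) (α β γ δ : ℝ) : Prop where
  pos_a : 0 < α
  pos_b : 0 < β
  pos_c : 0 < γ
  pos_d : 0 < δ
  sum_ac : α + γ = 1
  sum_bd : β + δ = 1
  eq : α • a + γ • c = β • b + δ • d
  indep : Indep3 a b c

namespace Crossing

variable {a b c d : Pt 2} {α β γ δ : ℝ}

/-- The space of affine relations between the four points is a line spanned by `(α, -β, γ, -δ)`. The
incidence facts about the quadrilateral are read off from these alternating signs. -/
theorem relation (h : Crossing a b c d α β γ δ) {x y z w : ℝ} (h0 : x + y + z + w = 0)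
    (h1 : x • a + y • b + z • c + w • d = 0) :
    ∃ k, x = k * α ∧ y = -(k * β) ∧ z = k * γ ∧ w = -(k * δ) := by
  have hδ := h.pos_d.ne'
  obtain ⟨e1, e2, e3⟩ := h.indep (x + w / δ * α) (y - w / δ * β) (z + w / δ * γ) (by
    have h2 : w / δ * δ = w := div_mul_cancel₀ _ hδ
    linear_combination h0 + h2 + (w / δ) * h.sum_ac - (w / δ) * h.sum_bd) (by
    have h2 : w = w / δ * δ := (div_mul_cancel₀ _ hδ).symm
    have h3 : w • d = (w / δ) • (δ • d) := by rw [smul_smul, ← h2]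
    rw [h3] at h1
    linear_combination (norm := module) h1 + (w / δ) • h.eq)
  refine ⟨-(w / δ), by linarith, by linarith, by linarith, ?_⟩
  field_simp

theorem swap_ac (h : Crossing a b c d α β γ δ) : Crossing c b a d γ β α δ where
  pos_a := h.pos_c
  pos_b := h.pos_b
  pos_c := h.pos_a
  pos_d := h.pos_d
  sum_ac := by linarith [h.sum_ac]
  sum_bd := h.sum_bd
  eq := by rw [← h.eq, add_comm]
  indep := h.indep.rotate.swap

theorem flip (h : Crossing a b c d α β γ δ) : Crossing b a d c β α δ γ where
  pos_a := h.pos_b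
  pos_b := h.pos_a
  pos_c := h.pos_d
  pos_d := h.pos_c
  sum_ac := h.sum_bd
  sum_bd := h.sum_ac
  eq := h.eq.symm
  indep := by
    intro x y z h0 h1
    obtain ⟨k, e1, e2, e3, e4⟩ := h.relation (x := y) (y := x) (z := 0) (w := z) (by linarith)
      (by rw [← h1]; module)
    have hk : k = 0 := by
      rcases mul_eq_zero.1 e3.symm with hk | hk
      · exact hk
      · exact absurd hk h.pos_c.ne'
    subst hk
    simp only [zero_mul, neg_zero] at e1 e2 e4
    exact ⟨e2, e1, e4⟩

theorem swap_bd (h : Crossing a b c d α β γ δ) : Crossing a d c b α δ γ β :=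
  h.flip.swap_ac.flip

theorem ne_ac (h : Crossing a b c d α β γ δ) : a ≠ c := h.indep.ne_all.2.2
theorem ne_ab (h : Crossing a b c d α β γ δ) : a ≠ b := h.indep.ne_all.1
theorem ne_bc (h : Crossing a b c d α β γ δ) : b ≠ c := h.indep.ne_all.2.1
theorem ne_bd (h : Crossing a b c d α β γ δ) : b ≠ d := h.flip.ne_ac
theorem ne_ad (h : Crossing a b c d α β γ δ) : a ≠ d := h.swap_bd.ne_ab
theorem ne_cd (h : Crossing a b c d α β γ δ) : c ≠ d := h.swap_bd.ne_bc.symm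

variable {σ τ σ' τ' : DSimplex 2}

/-- A convex combination of the four points is shifted along the affine relation until the weight of
`b` or of `d` vanishes. Comparing `u b / β` with `u d / δ` tells which vanishes first. -/
theorem body_eq_hull_subset (h : Crossing a b c d α β γ δ) (hσ : σ.IsTriangle a b c)
    (hτ : τ.IsTriangle a c d) : convexHull ℝ {a, b, c, d} ⊆ σ.body ∪ τ.body := by
  classical
  obtain ⟨w, hw⟩ : ∃ w : Finset (Pt 2), (w : Set (Pt 2)) = {a, b, c, d} := ⟨{a, b, c, d}, by simp⟩
  have hsum {M : Type} [AddCommMonoid M] (f : Pt 2 → M) :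
      ∑ y ∈ w, f y = f a + f b + f c + f d := by
    have h1 : w = {a, b, c, d} := Finset.coe_injective (by rw [hw]; simp)
    rw [h1, Finset.sum_insert (by simp [h.ne_ab, h.ne_ac, h.ne_ad]),
      Finset.sum_insert (by simp [h.ne_bc, h.ne_bd]), Finset.sum_pair h.ne_cd]
    simp only [add_assoc]
  rw [← hw]
  intro p hp
  obtain ⟨u, hu0, hu1, hu⟩ := Finset.mem_convexHull'.1 hp
  rw [hsum] at hu1 hu
  have hmem : ∀ {x}, x ∈ w ↔ x = a ∨ x = b ∨ x = c ∨ x = d := by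
    intro x; rw [← Finset.mem_coe, hw]; simp
  have ha := hu0 a (by simp [hmem])
  have hb := hu0 b (by simp [hmem])
  have hc := hu0 c (by simp [hmem])
  have hd := hu0 d (by simp [hmem])
  have hβ := h.pos_b
  have hδ := h.pos_d
  rcases le_total (u d / δ) (u b / β) with hle | hle
  · left
    have hk : 0 ≤ u d / δ := by positivity
    have h2 : u d / δ * δ = u d := div_mul_cancel₀ _ hδ.ne'
    have h3 : u d / δ * β ≤ u b := (le_div_iff₀ hβ).1 hle
    refine hσ.mem_body_iff.2 ⟨u a + u d / δ * α, u b - u d / δ * β, u c + u d / δ * γ, ?_, ?_, ?_,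
      ?_, ?_⟩
    · nlinarith [h.pos_a]
    · linarith
    · nlinarith [h.pos_c]
    · linear_combination hu1 + h2 + (u d / δ) * h.sum_ac - (u d / δ) * h.sum_bd
    · have h4 : (u d) • d = (u d / δ) • (δ • d) := by rw [smul_smul, h2]
      rw [← hu, h4]
      linear_combination (norm := module) (u d / δ) • h.eq
  · right
    have hk : 0 ≤ u b / β := by positivity
    have h2 : u b / β * β = u b := div_mul_cancel₀ _ hβ.ne'
    have h3 : u b / β * δ ≤ u d := (le_div_iff₀ hδ).1 hle
    refine hτ.mem_body_iff.2 ⟨u a + u b / β * α, u c + u b / β * γ, u d - u b / β * δ, ?_, ?_, ?_,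
      ?_, ?_⟩
    · nlinarith [h.pos_a]
    · nlinarith [h.pos_c]
    · linarith
    · linear_combination hu1 + h2 + (u b / β) * h.sum_ac - (u b / β) * h.sum_bd
    · have h4 : (u b) • b = (u b / β) • (β • b) := by rw [smul_smul, h2]
      rw [← hu, h4]
      linear_combination (norm := module) (u b / β) • h.eq

theorem body_union (h : Crossing a b c d α β γ δ) (hσ : σ.IsTriangle a b c)
    (hτ : τ.IsTriangle a c d) : σ.body ∪ τ.body = convexHull ℝ {a, b, c, d} := by
  refine (union_subset ?_ ?_).antisymm (h.body_eq_hull_subset hσ hτ)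
  · refine convexHull_mono (hσ.subset.trans ?_)
    rintro x (rfl | rfl | rfl) <;> simp
  · refine convexHull_mono (hτ.subset.trans ?_)
    rintro x (rfl | rfl | rfl) <;> simp

theorem body_union_flip (h : Crossing a b c d α β γ δ) (hσ : σ'.IsTriangle a b d)
    (hτ : τ'.IsTriangle b c d) : σ'.body ∪ τ'.body = convexHull ℝ {a, b, c, d} := by
  rw [h.flip.body_union hσ.swap hτ.rotate.swap.rotate.rotate]
  congr 1
  ext x
  simp
  tauto

theorem notMem_body (h : Crossing a b c d α β γ δ) (hσ : σ'.IsTriangle a b d) : c ∉ σ'.body := by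
  intro hc
  obtain ⟨x, y, w, hx, hy, hw, h1, h2⟩ := hσ.mem_body_iff.1 hc
  obtain ⟨k, e1, e2, e3, e4⟩ := h.relation (x := x) (y := y) (z := -1) (w := w) (by linarith)
    (by linear_combination (norm := module) h2)
  have := h.pos_c
  have := h.pos_a
  have hk : k < 0 := by by_contra! hk; nlinarith
  nlinarith

/-! ### Circles through the vertices of a quadrilateral -/

/-- The affine relation cancels the terms depending on `o`. The right-hand side is the height of the
diagonal `ac` above `bd` at the crossing point after lifting to the paraboloid. Taking `o` as a
circumcenter turns its sign into an in-circle test. -/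
theorem power_relation (h : Crossing a b c d α β γ δ) (o : Pt 2) :
    α * dist a o ^ 2 + γ * dist c o ^ 2 - β * dist b o ^ 2 - δ * dist d o ^ 2 =
      α * ‖a‖ ^ 2 + γ * ‖c‖ ^ 2 - β * ‖b‖ ^ 2 - δ * ‖d‖ ^ 2 := by
  have h2 : α * inner ℝ a o + γ * inner ℝ c o - β * inner ℝ b o - δ * inner ℝ d o = 0 := by
    have := congrArg (fun x => inner ℝ x o) h.eq
    simp only [inner_add_left, real_inner_smul_left] at this
    linarith
  simp only [dist_eq_norm, norm_sub_sq_real]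
  linear_combination (-2) * h2 + ‖o‖ ^ 2 * h.sum_ac - ‖o‖ ^ 2 * h.sum_bd

end Crossing

/-- A point beyond the edge `ac` but inside the circumcircle sees that edge between `a` and `c`.
Otherwise, say `z ≤ 0`, the triangle inequality applied to `x • (a - o) = (d - o) - y • (b - o) - z
• (c - o)` gives `x * ρ < (1 - y - z) * ρ = x * ρ`. -/
theorem exists_crossing {a b c d o : Pt 2} {ρ x y z : ℝ} (hi : Indep3 a b c) (ha : dist a o = ρ)
    (hb : dist b o = ρ) (hc : dist c o = ρ) (hd : dist d o < ρ) (hy : y < 0) (h1 : x + y + z = 1)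
    (hp : x • a + y • b + z • c = d) : ∃ α β γ δ, Crossing a b c d α β γ δ ∧
      0 < α * ‖a‖ ^ 2 + γ * ‖c‖ ^ 2 - β * ‖b‖ ^ 2 - δ * ‖d‖ ^ 2 := by
  have key : ∀ {a c : Pt 2} {x z : ℝ}, dist a o = ρ → dist c o = ρ → x + y + z = 1 →
      x • a + y • b + z • c = d → 0 < z := by
    intro a c x z ha hc h1 hp
    by_contra! hz
    have e : x • (a - o) = (d - o) + (-y) • (b - o) + (-z) • (c - o) := by
      obtain rfl : x = 1 - y - z := by linarith
      rw [← hp]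
      module
    have e2 := congrArg norm e
    have e3 := norm_add₃_le (a := d - o) (b := (-y) • (b - o)) (c := (-z) • (c - o))
    rw [← e2, norm_smul, norm_smul, norm_smul, ← dist_eq_norm, ← dist_eq_norm, ← dist_eq_norm,
      ← dist_eq_norm, ha, hb, hc, Real.norm_of_nonneg (by linarith : 0 ≤ x),
      Real.norm_of_nonneg (by linarith : 0 ≤ -y), Real.norm_of_nonneg (by linarith : 0 ≤ -z)] at e3
    have e4 := congrArg (· * ρ) h1
    simp only [add_mul] at e4
    linarith
  have hz := key ha hc h1 hp
  have hx := key hc ha (by linarith : z + y + x = 1) (by rw [← hp]; module)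
  have hs : 0 < 1 - y := by linarith
  have hcr : Crossing a b c d (x / (1 - y)) (-y / (1 - y)) (z / (1 - y)) (1 / (1 - y)) := by
    refine ⟨by positivity, div_pos (by linarith) hs, by positivity, by positivity, ?_, ?_, ?_, hi⟩
    · field_simp; linarith
    · field_simp; ring
    · rw [← hp]
      have e (t : ℝ) : t / (1 - y) = (1 - y)⁻¹ * t := by ring
      simp only [e, mul_smul, ← smul_add]
      congr 1
      module
  refine ⟨_, _, _, _, hcr, ?_⟩
  rw [← hcr.power_relation o, ha, hb, hc]
  have h2 : dist d o ^ 2 < ρ ^ 2 := pow_lt_pow_left₀ hd dist_nonneg two_ne_zero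
  have h3 := mul_lt_mul_of_pos_left h2 hcr.pos_d
  have h4 := congrArg (· * ρ ^ 2) hcr.sum_ac
  have h5 := congrArg (· * ρ ^ 2) hcr.sum_bd
  simp only [add_mul] at h4 h5
  linarith

/-- Suppose `ρ₃` exceeds both radii and write `o₃` in barycentric coordinates. Comparing squared
distances to `o₁` and `o₃` makes the weight of `d` negative; `o₂` does the same for `b`. Comparing
`a` with `o₃` then gives `y * dist b a ^ 2 + z * dist d a ^ 2 = 2 * ρ₃ ^ 2`, with a negative left
side. -/
theorem circumradius_le_max {a b d o₁ o₂ o₃ : Pt 2} {ρ₁ ρ₂ ρ₃ : ℝ} {σ : DSimplex 2}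
    (hσ : σ.IsTriangle a b d) (ha1 : dist a o₁ = ρ₁) (hb1 : dist b o₁ = ρ₁) (hd1 : dist d o₁ < ρ₁)
    (ha2 : dist a o₂ = ρ₂) (hd2 : dist d o₂ = ρ₂) (hb2 : dist b o₂ < ρ₂)
    (h3 : σ.IsCircumsphere o₃ ρ₃) : ρ₃ ≤ max ρ₁ ρ₂ := by
  by_contra! hlt
  obtain ⟨hlt1, hlt2⟩ := max_lt_iff.1 hlt
  obtain ⟨x, y, z, h1, hp⟩ := hσ.exists_coords o₃
  have ha3 := h3 a hσ.mem1
  have hb3 := h3 b hσ.mem2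
  have hd3 := h3 d hσ.mem3
  have key : ∀ {b d o₁ : Pt 2} {ρ₁ x y z : ℝ}, dist a o₁ = ρ₁ → dist b o₁ = ρ₁ → dist d o₁ < ρ₁ →
      dist b o₃ = ρ₃ → dist d o₃ = ρ₃ → ρ₁ < ρ₃ → x + y + z = 1 →
      x • a + y • b + z • d = o₃ → z < 0 := by
    intro b d o₁ ρ₁ x y z ha1 hb1 hd1 hb3 hd3 hlt h1 hp
    have hx := sum_weights_sq_dist_triple o₁ o₃ h1 hp
    simp only [ha1, hb1, ha3, hb3, hd3, dist_self] at hx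
    have h5 : dist d o₁ ^ 2 < ρ₁ ^ 2 := pow_lt_pow_left₀ hd1 dist_nonneg two_ne_zero
    have h6 : ρ₁ ^ 2 < ρ₃ ^ 2 := pow_lt_pow_left₀ hlt (ha1 ▸ dist_nonneg) two_ne_zero
    have h7 := sq_nonneg (dist o₃ o₁)
    have h8 := congrArg (· * (ρ₁ ^ 2 - ρ₃ ^ 2)) h1
    simp only [add_mul] at h8
    by_contra! hz
    nlinarith [mul_nonneg hz (sub_nonneg.2 h5.le)]
  have hz := key ha1 hb1 hd1 hb3 hd3 hlt1 h1 hp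
  have hy := key ha2 hd2 hb2 hd3 hb3 hlt2 (by linarith : x + z + y = 1) (by rw [← hp]; module)
  have hx := sum_weights_sq_dist_triple a o₃ h1 hp
  simp only [ha3, hb3, hd3, dist_self] at hx
  rw [dist_comm o₃ a, ha3] at hx
  have h4 : 0 < ρ₃ ^ 2 := pow_pos ((ha1 ▸ dist_nonneg : 0 ≤ ρ₁).trans_lt hlt1) 2
  have h5 := congrArg (· * ρ₃ ^ 2) h1
  simp only [add_mul] at h5
  nlinarith [mul_nonneg (neg_nonneg.2 hy.le) (sq_nonneg (dist b a)),
    mul_nonneg (neg_nonneg.2 hz.le) (sq_nonneg (dist d a))]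

/-! ### Finite patches of triangles and flips -/

/-- The triangles in `K` fit together face to face, have their vertices in `X`, contain no other
points of `X`, have circumradius at most `q`, and cover `A`. -/
structure IsPatch (X : Set (Pt 2)) (q : ℝ) (A : Set (Pt 2)) (K : Finset (DSimplex 2)) : Prop where
  verts_subset : ∀ σ ∈ K, (σ.verts : Set (Pt 2)) ⊆ X
  circumradiusLE : ∀ σ ∈ K, σ.CircumradiusLE q
  inter : ∀ σ ∈ K, ∀ τ ∈ K, σ.body ∩ τ.body ⊆ convexHull ℝ (σ.verts ∩ τ.verts : Set (Pt 2))
  cover : ⋃ σ ∈ K, σ.body = A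
  vertex : ∀ σ ∈ K, X ∩ σ.body ⊆ σ.verts

theorem DSimplex.exists_third (ω : DSimplex 2) {a c : Pt 2} (hac : a ≠ c) (ha : a ∈ ω.verts)
    (hc : c ∈ ω.verts) : ∃ y, ω.IsTriangle a c y := by
  classical
  have hc' : c ∈ ω.verts.erase a := Finset.mem_erase.2 ⟨hac.symm, hc⟩
  have hcard : ((ω.verts.erase a).erase c).card = 1 := by
    rw [Finset.card_erase_of_mem hc', Finset.card_erase_of_mem ha, ω.card_verts]
  obtain ⟨y, hy⟩ := Finset.card_eq_one.1 hcard
  have h2 : ω.verts = {a, c, y} := by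
    rw [← hy, Finset.insert_erase hc', Finset.insert_erase ha]
  refine ⟨y, ?_⟩
  rw [DSimplex.IsTriangle, h2]
  simp

namespace Crossing

variable {a b c d : Pt 2} {α β γ δ : ℝ} {σ τ ω σ' τ' : DSimplex 2}

/-- The crossing point would lie in both triangles, so meeting face to face would force `ω` to have
all four vertices. Hence the triangles created by a flip are new. -/
theorem not_mem_and_mem (h : Crossing a b c d α β γ δ) (hσ : σ.IsTriangle a b c)
    (hinter : σ.body ∩ ω.body ⊆ convexHull ℝ (σ.verts ∩ ω.verts : Set (Pt 2))) :
    ¬(b ∈ ω.verts ∧ d ∈ ω.verts) := by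
  classical
  rintro ⟨hb, hd⟩
  have h1 : α • a + (0 : ℝ) • b + γ • c ∈ σ.body :=
    hσ.mem_body_iff.2 ⟨_, _, _, h.pos_a.le, le_rfl, h.pos_c.le, by linarith [h.sum_ac], rfl⟩
  have h2 : α • a + (0 : ℝ) • b + γ • c ∈ ω.body := by
    rw [zero_smul, add_zero, h.eq]
    exact (convex_convexHull ℝ _) (ω.verts_subset_body hb) (ω.verts_subset_body hd) h.pos_b.le
      h.pos_d.le h.sum_bd
  obtain ⟨ha, -, hc⟩ := hσ.coords_of_mem_convexHull inter_subset_left (by linarith [h.sum_ac])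
    (hinter ⟨h1, h2⟩)
  have hsub : ({a, b, c, d} : Finset (Pt 2)) ⊆ ω.verts := by
    intro x hx
    simp only [Finset.mem_insert, Finset.mem_singleton] at hx
    rcases hx with rfl | rfl | rfl | rfl
    exacts [(ha h.pos_a.ne').2, hb, (hc h.pos_c.ne').2, hd]
  have := Finset.card_le_card hsub
  rw [ω.card_verts, Finset.card_insert_of_notMem (by simp [h.ne_ab, h.ne_ac, h.ne_ad]),
    Finset.card_insert_of_notMem (by simp [h.ne_bc, h.ne_bd]), Finset.card_pair h.ne_cd] at this
  omega

/-- Here `y` is on the same side of `ac` as `b`. Moving the crossing point slightly towards `y`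
stays in both triangles, so `y` must be a common vertex. -/
theorem eq_of_coord_nonneg (h : Crossing a b c d α β γ δ) (hσ : σ.IsTriangle a b c)
    (hinter : ω.body ∩ σ.body ⊆ convexHull ℝ (ω.verts ∩ σ.verts : Set (Pt 2))) {y : Pt 2}
    (hω : ω.IsTriangle a c y) {u v w : ℝ} (hv : 0 ≤ v) (h1 : u + v + w = 1)
    (hy : u • a + v • b + w • c = y) : ω = σ := by
  obtain ⟨ε, hε0, hε1, hεu, hεw⟩ : ∃ ε : ℝ, 0 < ε ∧ ε < 1 ∧ 0 ≤ (1 - ε) * α + ε * u ∧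
      0 ≤ (1 - ε) * γ + ε * w := by
    have key (s t : ℝ) (hs : 0 < s) : ∀ᶠ ε : ℝ in nhds 0, 0 ≤ (1 - ε) * s + ε * t := by
      have : Continuous fun ε : ℝ => (1 - ε) * s + ε * t := by fun_prop
      have h2 := this.tendsto 0
      simp only [sub_zero, one_mul, zero_mul, add_zero] at h2
      exact (h2.eventually_const_lt hs).mono fun _ => le_of_lt
    have hev := ((key α u h.pos_a).and (key γ w h.pos_c)).filter_mono
      (nhdsWithin_le_nhds (s := Ioi (0 : ℝ)))
    obtain ⟨ε, ⟨h3, h4⟩, h5⟩ := (hev.and (Ioo_mem_nhdsGT one_pos)).exists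
    exact ⟨ε, h5.1, h5.2, h3, h4⟩
  have hp : ((1 - ε) * α) • a + ((1 - ε) * γ) • c + ε • y ∈ σ.body := by
    refine hσ.mem_body_iff.2 ⟨_, ε * v, _, hεu, by positivity, hεw, ?_, ?_⟩
    · linear_combination (1 - ε) * h.sum_ac + ε * h1
    · rw [← hy]; module
  have hs : (1 - ε) * α + (1 - ε) * γ + ε = 1 := by linear_combination (1 - ε) * h.sum_ac
  have hp' : ((1 - ε) * α) • a + ((1 - ε) * γ) • c + ε • y ∈ ω.body :=
    hω.mem_body_iff.2 ⟨_, _, _, mul_nonneg (by linarith) h.pos_a.le,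
      mul_nonneg (by linarith) h.pos_c.le, hε0.le, hs, rfl⟩
  have hyσ := ((hω.coords_of_mem_convexHull inter_subset_left hs (hinter ⟨hp', hp⟩)).2.2 hε0.ne').2
  refine DSimplex.eq_of_subset fun x hx => ?_
  rcases hω.mem_iff.1 hx with rfl | rfl | rfl
  exacts [hσ.mem1, hσ.mem3, hyσ]

theorem eq_or_eq_of_mem (h : Crossing a b c d α β γ δ) (hσ : σ.IsTriangle a b c)
    (hτ : τ.IsTriangle a c d)
    (hωσ : ω.body ∩ σ.body ⊆ convexHull ℝ (ω.verts ∩ σ.verts : Set (Pt 2)))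
    (hωτ : ω.body ∩ τ.body ⊆ convexHull ℝ (ω.verts ∩ τ.verts : Set (Pt 2)))
    (ha : a ∈ ω.verts) (hc : c ∈ ω.verts) : ω = σ ∨ ω = τ := by
  obtain ⟨y, hω⟩ := ω.exists_third h.ne_ac ha hc
  obtain ⟨u, v, w, h1, hy⟩ := hσ.exists_coords y
  rcases le_total 0 v with hv | hv
  · exact Or.inl (h.eq_of_coord_nonneg hσ hωσ hω hv h1 hy)
  · right
    have hβ := h.pos_b
    have e : v / β * β = v := div_mul_cancel₀ _ hβ.ne'
    refine h.swap_bd.eq_of_coord_nonneg hτ.rotate.rotate.swap hωτ hω (u := u + v / β * α)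
      (v := -(v / β * δ)) (w := w + v / β * γ) ?_ ?_ ?_
    · have := mul_nonneg (div_nonneg (neg_nonneg.2 hv) hβ.le) h.pos_d.le
      rw [neg_div] at this
      linarith
    · linear_combination h1 + e + (v / β) * h.sum_ac - (v / β) * h.sum_bd
    · rw [← hy]
      have e2 : v • b = (v / β) • (β • b) := by rw [smul_smul, e]
      rw [e2]
      linear_combination (norm := module) (v / β) • h.eq

/-- The weights of `p` in `σ` live on vertices shared with `ω`, so `a` and `c` are not both used.
Positive weight at `c` would leave `p` on the edge `bc` away from `b`, which the signs in `relation`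
exclude from `σ'`. So `p` is spanned by shared vertices among `a` and `b`. -/
theorem mem_convexHull_of_mem_body (h : Crossing a b c d α β γ δ) (hσ : σ.IsTriangle a b c)
    (hσ' : σ'.IsTriangle a b d)
    (hinter : σ.body ∩ ω.body ⊆ convexHull ℝ (σ.verts ∩ ω.verts : Set (Pt 2)))
    (hac : ¬(a ∈ ω.verts ∧ c ∈ ω.verts)) {p : Pt 2} (hpσ : p ∈ σ.body) (hpσ' : p ∈ σ'.body)
    (hpω : p ∈ ω.body) : p ∈ convexHull ℝ (ω.verts ∩ σ'.verts : Set (Pt 2)) := by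
  obtain ⟨x, y, z, hx, hy, hz, h1, rfl⟩ := hσ.mem_body_iff.1 hpσ
  obtain ⟨ha, hb, hc⟩ := hσ.coords_of_mem_convexHull inter_subset_left h1 (hinter ⟨hpσ, hpω⟩)
  have hz0 : z = 0 := by
    by_contra hz0
    have hx0 : x = 0 := by
      by_contra hx0
      exact hac ⟨(ha hx0).2, (hc hz0).2⟩
    obtain ⟨x', y', w', hx', hy', hw', h2, h3⟩ := hσ'.mem_body_iff.1 hpσ'
    obtain ⟨k, e1, e2, e3, e4⟩ := h.relation (x := x' - x) (y := y' - y) (z := -z) (w := w')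
      (by linarith) (by linear_combination (norm := module) h3)
    have := h.pos_c
    have := h.pos_a
    have hz' : 0 < z := lt_of_le_of_ne hz (Ne.symm hz0)
    have hk : k < 0 := by by_contra! hk; nlinarith
    nlinarith
  refine mem_convexHull_of_coords hx hy hz h1 (fun h0 => ⟨(ha h0).2, hσ'.mem1⟩)
    (fun h0 => ⟨(hb h0).2, hσ'.mem2⟩) (fun h0 => absurd hz0 h0)

theorem inter_flip (h : Crossing a b c d α β γ δ) (hσ' : σ'.IsTriangle a b d)
    (hτ' : τ'.IsTriangle b c d) :
    σ'.body ∩ τ'.body ⊆ convexHull ℝ (σ'.verts ∩ τ'.verts : Set (Pt 2)) := by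
  rintro p ⟨hp, hp'⟩
  obtain ⟨x, y, w, hx, hy, hw, h1, rfl⟩ := hσ'.mem_body_iff.1 hp
  obtain ⟨y', z', w', hy', hz', hw', h1', h2⟩ := hτ'.mem_body_iff.1 hp'
  obtain ⟨k, e1, e2, e3, e4⟩ := h.relation (x := x) (y := y - y') (z := -z') (w := w - w')
    (by linarith) (by linear_combination (norm := module) -h2)
  have := h.pos_c
  have := h.pos_a
  have hk1 : 0 ≤ k := by by_contra! hk; nlinarith
  have hk2 : k ≤ 0 := by by_contra! hk; nlinarith
  have hx0 : x = 0 := by rw [e1, le_antisymm hk2 hk1, zero_mul]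
  exact mem_convexHull_of_coords hx hy hw h1 (fun h0 => absurd hx0 h0)
    (fun _ => ⟨hσ'.mem2, hτ'.mem1⟩) (fun _ => ⟨hσ'.mem3, hτ'.mem3⟩)

theorem dist_lt (h : Crossing a b c d α β γ δ)
    (hD : 0 < α * ‖a‖ ^ 2 + γ * ‖c‖ ^ 2 - β * ‖b‖ ^ 2 - δ * ‖d‖ ^ 2) {o : Pt 2} {ρ : ℝ}
    (ha : dist a o = ρ) (hb : dist b o = ρ) (hc : dist c o = ρ) : dist d o < ρ := by
  rw [← h.power_relation o, ha, hb, hc] at hD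
  refine lt_of_pow_lt_pow_left₀ 2 (ha ▸ dist_nonneg) ?_
  have e1 := congrArg (· * ρ ^ 2) h.sum_ac
  have e2 := congrArg (· * ρ ^ 2) h.sum_bd
  simp only [add_mul] at e1 e2
  have := h.pos_d
  by_contra! hle
  nlinarith

theorem lt_dist (h : Crossing a b c d α β γ δ)
    (hD : 0 < α * ‖a‖ ^ 2 + γ * ‖c‖ ^ 2 - β * ‖b‖ ^ 2 - δ * ‖d‖ ^ 2) {o : Pt 2} {ρ : ℝ}
    (ha : dist a o = ρ) (hb : dist b o = ρ) (hd : dist d o = ρ) : ρ < dist c o := by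
  rw [← h.power_relation o, ha, hb, hd] at hD
  refine lt_of_pow_lt_pow_left₀ 2 dist_nonneg ?_
  have e1 := congrArg (· * ρ ^ 2) h.sum_ac
  have e2 := congrArg (· * ρ ^ 2) h.sum_bd
  simp only [add_mul] at e1 e2
  have := h.pos_c
  by_contra! hle
  nlinarith

theorem circumradiusLE_flip (h : Crossing a b c d α β γ δ)
    (hD : 0 < α * ‖a‖ ^ 2 + γ * ‖c‖ ^ 2 - β * ‖b‖ ^ 2 - δ * ‖d‖ ^ 2)
    (hσ : σ.IsTriangle a b c) (hτ : τ.IsTriangle a c d) (hσ' : σ'.IsTriangle a b d) {q : ℝ}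
    (hσq : σ.CircumradiusLE q) (hτq : τ.CircumradiusLE q) : σ'.CircumradiusLE q := by
  obtain ⟨o₁, ρ₁, h1, hq1⟩ := hσq
  obtain ⟨o₂, ρ₂, h2, hq2⟩ := hτq
  obtain ⟨o₃, ρ₃, h3⟩ := σ'.exists_isCircumsphere
  refine ⟨o₃, ρ₃, h3, (circumradius_le_max hσ' (h1 a hσ.mem1) (h1 b hσ.mem2) ?_ (h2 a hτ.mem1)
    (h2 d hτ.mem3) ?_ h3).trans (max_le hq1 hq2)⟩
  · exact h.dist_lt hD (h1 a hσ.mem1) (h1 b hσ.mem2) (h1 c hσ.mem3)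
  · exact h.swap_bd.dist_lt (by linarith) (h2 a hτ.mem1) (h2 d hτ.mem3) (h2 c hτ.mem2)

end Crossing

-- The delicate point is how an untouched triangle meets the new ones. No third triangle of the
-- patch contains the edge `ac`, so `mem_convexHull_of_mem_body` applies, the other cases following
-- by the symmetries of the quadrilateral.
open Classical in
theorem IsPatch.flip {X A : Set (Pt 2)} {q : ℝ} {K : Finset (DSimplex 2)} (hK : IsPatch X q A K)
    {a b c d : Pt 2} {α β γ δ : ℝ} {σ τ σ' τ' : DSimplex 2} (h : Crossing a b c d α β γ δ)
    (hD : 0 < α * ‖a‖ ^ 2 + γ * ‖c‖ ^ 2 - β * ‖b‖ ^ 2 - δ * ‖d‖ ^ 2)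
    (hσK : σ ∈ K) (hτK : τ ∈ K) (hσ : σ.IsTriangle a b c) (hτ : τ.IsTriangle a c d)
    (hσ' : σ'.IsTriangle a b d) (hτ' : τ'.IsTriangle b c d) :
    IsPatch X q A ((K \ {σ, τ}) ∪ {σ', τ'}) := by
  have hσac : σ.IsTriangle c b a := hσ.rotate.swap
  have hτac : τ.IsTriangle c a d := hτ.swap
  have hσ'ac : σ'.IsTriangle b a d := hσ'.swap
  have hτ'ac : τ'.IsTriangle c b d := hτ'.swap
  have hσbd : τ.IsTriangle a d c := hτ.rotate.rotate.swap
  have hσ'bd : σ'.IsTriangle a d b := hσ'.rotate.rotate.swap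
  have haX := hK.verts_subset σ hσK hσ.mem1
  have hbX := hK.verts_subset σ hσK hσ.mem2
  have hcX := hK.verts_subset σ hσK hσ.mem3
  have hdX := hK.verts_subset τ hτK hτ.mem3
  have hunion : σ'.body ∪ τ'.body = σ.body ∪ τ.body := by
    rw [h.body_union_flip hσ' hτ', h.body_union hσ hτ]
  have hX : ∀ x ∈ X, x ∈ σ.body ∪ τ.body → x = a ∨ x = b ∨ x = c ∨ x = d := by
    rintro x hx (hxσ | hxτ)
    · have := hσ.mem_iff.1 (hK.vertex σ hσK ⟨hx, hxσ⟩)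
      tauto
    · have := hτ.mem_iff.1 (hK.vertex τ hτK ⟨hx, hxτ⟩)
      tauto
  have hmem : ∀ ω ∈ (K \ {σ, τ}) ∪ {σ', τ'}, (ω ∈ K ∧ ω ≠ σ ∧ ω ≠ τ) ∨ ω = σ' ∨ ω = τ' := by
    intro ω hω
    simp only [Finset.mem_union, Finset.mem_sdiff, Finset.mem_insert, Finset.mem_singleton,
      not_or] at hω
    exact hω
  have hinter1 : ∀ ω ∈ K, ω ≠ σ → ω ≠ τ → ω.body ∩ σ'.body ⊆
      convexHull ℝ (ω.verts ∩ σ'.verts : Set (Pt 2)) := by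
    rintro ω hω hne1 hne2 p ⟨hpω, hp⟩
    have hac : ¬(a ∈ ω.verts ∧ c ∈ ω.verts) := fun hac =>
      (h.eq_or_eq_of_mem hσ hτ (hK.inter ω hω σ hσK) (hK.inter ω hω τ hτK) hac.1 hac.2).elim
        hne1 hne2
    rcases (hunion ▸ Or.inl hp : p ∈ σ.body ∪ τ.body) with hpσ | hpτ
    · exact h.mem_convexHull_of_mem_body hσ hσ' (hK.inter σ hσK ω hω) hac hpσ hp hpω
    · exact h.swap_bd.mem_convexHull_of_mem_body hσbd hσ'bd (hK.inter τ hτK ω hω) hac hpτ hp hpω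
  have hinter2 : ∀ ω ∈ K, ω ≠ σ → ω ≠ τ → ω.body ∩ τ'.body ⊆
      convexHull ℝ (ω.verts ∩ τ'.verts : Set (Pt 2)) := by
    rintro ω hω hne1 hne2 p ⟨hpω, hp⟩
    have hac : ¬(c ∈ ω.verts ∧ a ∈ ω.verts) := fun hac =>
      (h.eq_or_eq_of_mem hσ hτ (hK.inter ω hω σ hσK) (hK.inter ω hω τ hτK) hac.2 hac.1).elim
        hne1 hne2
    rcases (hunion ▸ Or.inr hp : p ∈ σ.body ∪ τ.body) with hpσ | hpτ
    · exact h.swap_ac.mem_convexHull_of_mem_body hσac hτ'ac (hK.inter σ hσK ω hω) hac hpσ hp hpω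
    · exact h.swap_ac.swap_bd.mem_convexHull_of_mem_body hτac.rotate.rotate.swap
        hτ'ac.rotate.rotate.swap (hK.inter τ hτK ω hω) hac hpτ hp hpω
  refine ⟨fun ω hω => ?_, fun ω hω => ?_, fun ω hω ω' hω' => ?_, ?_, fun ω hω => ?_⟩
  · rcases hmem ω hω with ⟨hω, -⟩ | rfl | rfl
    · exact hK.verts_subset ω hω
    · rw [hσ']; rintro x (rfl | rfl | rfl) <;> assumption
    · rw [hτ']; rintro x (rfl | rfl | rfl) <;> assumption
  · rcases hmem ω hω with ⟨hω, -⟩ | rfl | rfl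
    · exact hK.circumradiusLE ω hω
    · exact h.circumradiusLE_flip hD hσ hτ hσ' (hK.circumradiusLE σ hσK)
        (hK.circumradiusLE τ hτK)
    · exact h.swap_ac.circumradiusLE_flip (by linarith) hσac hτac hτ'ac (hK.circumradiusLE σ hσK)
        (hK.circumradiusLE τ hτK)
  · rcases hmem ω hω with ⟨hωK, hn1, hn2⟩ | rfl | rfl <;>
      rcases hmem ω' hω' with ⟨hωK', hn1', hn2'⟩ | rfl | rfl
    · exact hK.inter ω hωK ω' hωK'
    · exact hinter1 ω hωK hn1 hn2
    · exact hinter2 ω hωK hn1 hn2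
    · rw [inter_comm, inter_comm (ω.verts : Set (Pt 2))]; exact hinter1 ω' hωK' hn1' hn2'
    · rw [inter_self, inter_self]; rfl
    · exact h.inter_flip hσ' hτ'
    · rw [inter_comm, inter_comm (ω.verts : Set (Pt 2))]; exact hinter2 ω' hωK' hn1' hn2'
    · rw [inter_comm, inter_comm (ω.verts : Set (Pt 2))]; exact h.inter_flip hσ' hτ'
    · rw [inter_self, inter_self]; rfl
  · rw [← hK.cover, Finset.set_biUnion_union, Finset.set_biUnion_insert,
      Finset.set_biUnion_singleton, hunion]
    apply Subset.antisymm
    · refine union_subset (biUnion_subset_biUnion_left fun ω hω => (Finset.mem_sdiff.1 hω).1)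
        (union_subset ?_ ?_)
      · exact subset_biUnion_of_mem (u := fun σ : DSimplex 2 => σ.body) hσK
      · exact subset_biUnion_of_mem (u := fun σ : DSimplex 2 => σ.body) hτK
    · refine iUnion₂_subset fun ω hω => ?_
      rcases eq_or_ne ω σ with rfl | h1
      · exact fun x hx => Or.inr (Or.inl hx)
      rcases eq_or_ne ω τ with rfl | h2
      · exact fun x hx => Or.inr (Or.inr hx)
      · exact fun x hx => Or.inl (mem_biUnion (x := ω) (by simp [hω, h1, h2]) hx)
  · rcases hmem ω hω with ⟨hω, -⟩ | rfl | rfl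
    · exact hK.vertex ω hω
    · rintro x ⟨hx, hxb⟩
      rcases hX x hx (hunion ▸ Or.inl hxb) with rfl | rfl | rfl | rfl
      · exact hσ'.mem1
      · exact hσ'.mem2
      · exact absurd hxb (h.notMem_body hσ')
      · exact hσ'.mem3
    · rintro x ⟨hx, hxb⟩
      rcases hX x hx (hunion ▸ Or.inr hxb) with rfl | rfl | rfl | rfl
      · exact absurd hxb (h.swap_ac.notMem_body hτ'ac)
      · exact hτ'.mem1
      · exact hτ'.mem2
      · exact hτ'.mem3

/-! ### Flips decrease the sum of a functional in `ClassF` -/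

open Classical in
/-- The simplicial complex spanned by `d`-simplices that fit together face to face. -/
def complexOfDSimplices {d : ℕ} (S : Set (DSimplex d)) (hS : ∀ σ ∈ S, ∀ τ ∈ S,
    σ.body ∩ τ.body ⊆ convexHull ℝ (σ.verts ∩ τ.verts : Set (Pt d))) :
    Geometry.SimplicialComplex ℝ (Pt d) where
  faces := {t | t.Nonempty ∧ ∃ σ ∈ S, t ⊆ σ.verts}
  indep := by
    rintro s ⟨-, σ, -, hs⟩
    exact AffineIndependent.mono σ.2.2 (t := (σ.verts : Set (Pt d))) (Finset.coe_subset.2 hs)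
  isRelLowerSet_faces := by
    rintro s ⟨hne, σ, hσ, hs⟩
    exact ⟨hne, fun t hts ht => ⟨ht, σ, hσ, hts.trans hs⟩⟩
  inter_subset_convexHull := by
    rintro s t ⟨-, σ, hσ, hs⟩ ⟨-, τ, hτ, ht⟩ p ⟨hps, hpt⟩
    have hp := hS σ hσ τ hτ ⟨convexHull_mono (Finset.coe_subset.2 hs) hps,
      convexHull_mono (Finset.coe_subset.2 ht) hpt⟩
    rw [← Finset.coe_inter] at hp
    -- Independence inside `σ` and inside `τ` brings both hulls down to faces of the common face,
    -- where a third application intersects them.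
    have e1 := σ.2.2.convexHull_inter hs (Finset.inter_subset_left (s₁ := σ.verts) (s₂ := τ.verts))
    have e2 := τ.2.2.convexHull_inter ht (Finset.inter_subset_right (s₁ := σ.verts) (s₂ := τ.verts))
    have p1 := e1.symm.subset ⟨hps, hp⟩
    have p2 := e2.symm.subset ⟨hpt, hp⟩
    rw [← Finset.coe_inter] at p1 p2
    have e3 := τ.2.2.convexHull_inter (t₁ := s ∩ (σ.verts ∩ τ.verts))
      (t₂ := t ∩ (σ.verts ∩ τ.verts))
      (Finset.inter_subset_right.trans Finset.inter_subset_right)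
      (Finset.inter_subset_right.trans Finset.inter_subset_right)
    refine convexHull_mono ?_ (e3.symm.subset ⟨p1, p2⟩)
    simp only [Finset.coe_inter]
    exact inter_subset_inter inter_subset_left inter_subset_left

namespace Crossing

variable {a b c d : Pt 2} {α β γ δ : ℝ} {σ τ σ' τ' : DSimplex 2}

theorem ne_of_isTriangle (h : Crossing a b c d α β γ δ) (hσ : σ.IsTriangle a b c)
    (hτ : τ.IsTriangle a c d) : σ ≠ τ := by
  rintro rfl
  rcases hτ.mem_iff.1 hσ.mem2 with hb | hb | hb
  exacts [h.ne_ab hb.symm, h.ne_bc hb, h.ne_bd hb]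

/-- The old pair triangulates the quadrilateral, and by `hD` the new pair consists precisely of its
empty triangles. -/
theorem add_le_add_of_mem_classF (h : Crossing a b c d α β γ δ)
    (hD : 0 < α * ‖a‖ ^ 2 + γ * ‖c‖ ^ 2 - β * ‖b‖ ^ 2 - δ * ‖d‖ ^ 2)
    (hgen : IsGeneric ({a, b, c, d} : Set (Pt 2))) {F : DSimplex 2 → ℝ} (hF : F ∈ ClassF 2)
    (hσ : σ.IsTriangle a b c) (hτ : τ.IsTriangle a c d)
    (hσ' : σ'.IsTriangle a b d) (hτ' : τ'.IsTriangle b c d) : F σ' + F τ' ≤ F σ + F τ := by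
  classical
  set Y : Finset (Pt 2) := {a, b, c, d} with hYdef
  have hYc : (Y : Set (Pt 2)) = {a, b, c, d} := by simp [hYdef]
  have hcard : Y.card = 4 := by
    rw [hYdef, Finset.card_insert_of_notMem (by simp [h.ne_ab, h.ne_ac, h.ne_ad]),
      Finset.card_insert_of_notMem (by simp [h.ne_bc, h.ne_bd]), Finset.card_pair h.ne_cd]
  have hσbd : τ.IsTriangle a d c := hτ.rotate.rotate.swap
  have hτ'ac : τ'.IsTriangle c b d := hτ'.swap
  have hinter : σ.body ∩ τ.body ⊆ convexHull ℝ (σ.verts ∩ τ.verts : Set (Pt 2)) :=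
    h.flip.inter_flip hσ.swap hσbd
  have hself (σ : DSimplex 2) :
      σ.body ∩ σ.body ⊆ convexHull ℝ (σ.verts ∩ σ.verts : Set (Pt 2)) := by
    rw [inter_self, inter_self]; rfl
  have hS : ∀ ω ∈ ({σ, τ} : Set (DSimplex 2)), ∀ ω' ∈ ({σ, τ} : Set (DSimplex 2)),
      ω.body ∩ ω'.body ⊆ convexHull ℝ (ω.verts ∩ ω'.verts : Set (Pt 2)) := by
    rintro ω (rfl | rfl) ω' (rfl | rfl)
    · exact hself _
    · exact hinter
    · rw [inter_comm, inter_comm (ω.verts : Set (Pt 2))]; exact hinter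
    · exact hself _
  set T := complexOfDSimplices {σ, τ} hS with hT
  have hconv : ∀ y ∈ Y, y ∉ convexHull ℝ ((Y : Set (Pt 2)) \ {y}) := by
    have key : ∀ {a b c d : Pt 2} {α β γ δ : ℝ} {ω : DSimplex 2}, Crossing a b c d α β γ δ →
        ω.IsTriangle a b d → (Y : Set (Pt 2)) = {a, b, c, d} →
        c ∉ convexHull ℝ ((Y : Set (Pt 2)) \ {c}) := by
      intro a b c d α β γ δ ω h hω hY hc
      refine h.notMem_body hω (convexHull_mono ?_ hc)
      rw [hY, hω]
      rintro x ⟨rfl | rfl | rfl | rfl, hx⟩ <;> simp at hx ⊢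
    intro y hy
    have hy' : y ∈ (Y : Set (Pt 2)) := hy
    rw [hYc] at hy'
    rcases hy' with rfl | rfl | rfl | rfl
    · exact key h.swap_ac hτ'ac (by rw [hYc]; ext; simp; tauto)
    · exact key h.flip.swap_ac hτ.rotate.rotate (by rw [hYc]; ext; simp; tauto)
    · exact key h hσ' hYc
    · exact key h.flip hσ.swap (by rw [hYc]; ext; simp; tauto)
  have hfin : IsFiniteTriangulation T Y := by
    constructor
    · ext x
      rw [hYc]
      simp only [hT, complexOfDSimplices, Geometry.SimplicialComplex.vertices, mem_ofPred_eq,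
        Finset.singleton_nonempty, true_and, Finset.singleton_subset_iff, mem_insert_iff,
        mem_singleton_iff, exists_eq_or_imp, exists_eq_left, hσ.mem_iff, hτ.mem_iff]
      tauto
    · rw [hYc, ← h.body_union hσ hτ]
      ext x
      rw [Geometry.SimplicialComplex.mem_space_iff]
      constructor
      · rintro ⟨s, ⟨-, ω, hω, hs⟩, hx⟩
        have hxω : x ∈ ω.body := convexHull_mono (Finset.coe_subset.2 hs) hx
        rcases hω with rfl | rfl
        exacts [Or.inl hxω, Or.inr hxω]
      · rintro (hx | hx)
        · exact ⟨σ.verts, ⟨σ.nonempty_verts, σ, by simp, subset_rfl⟩, hx⟩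
        · exact ⟨τ.verts, ⟨τ.nonempty_verts, τ, by simp, subset_rfl⟩, hx⟩
  have hle := hF.2 Y hcard (hYc ▸ hgen) hconv T hfin
  rw [simplexSum_eq_sum F T.faces univ {σ, τ}, Finset.sum_pair (h.ne_of_isTriangle hσ hτ),
    simplexSum_eq_sum F (delaunay (Y : Set (Pt 2))) univ {σ', τ'},
    Finset.sum_pair (h.flip.ne_of_isTriangle hσ'.swap hτ'.rotate.rotate.swap)] at hle
  · exact hle
  · intro ω
    simp only [Finset.mem_insert, Finset.mem_singleton, subset_univ, and_true,
      DSimplex.verts_mem_delaunay]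
    constructor
    · rintro (rfl | rfl)
      · obtain ⟨o, ρ, ho⟩ := ω.exists_isCircumsphere
        have e1 := ho a hσ'.mem1
        have e2 := ho b hσ'.mem2
        have e3 := ho d hσ'.mem3
        have e4 := h.lt_dist hD e1 e2 e3
        refine ⟨by rw [hσ', hYc]; rintro x (rfl | rfl | rfl) <;> simp, o, ρ, ho, ?_⟩
        rw [hYc, eq_empty_iff_forall_notMem]
        rintro x ⟨rfl | rfl | rfl | rfl, hx⟩ <;> rw [mem_ball] at hx <;> linarith
      · obtain ⟨o, ρ, ho⟩ := ω.exists_isCircumsphere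
        have e1 := ho b hτ'.mem1
        have e2 := ho c hτ'.mem2
        have e3 := ho d hτ'.mem3
        have e4 := h.swap_ac.lt_dist (by linarith) e2 e1 e3
        refine ⟨by rw [hτ', hYc]; rintro x (rfl | rfl | rfl) <;> simp, o, ρ, ho, ?_⟩
        rw [hYc, eq_empty_iff_forall_notMem]
        rintro x ⟨rfl | rfl | rfl | rfl, hx⟩ <;> rw [mem_ball] at hx <;> linarith
    · rintro ⟨hω, o, ρ, ho, he⟩
      have hωY : ω.verts ⊆ Y := Finset.coe_subset.1 hω
      -- An empty triangle omits one of the four points. Omitting `b` or `d` is impossible, since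
      -- that point would lie in the open circumdisc.
      obtain ⟨y, hy, hyω⟩ : ∃ y ∈ Y, y ∉ ω.verts := by
        by_contra! hall
        have := Finset.card_le_card (show Y ⊆ ω.verts from hall)
        rw [hcard, ω.card_verts] at this
        omega
      have heq : ω.verts = Y.erase y := by
        refine Finset.eq_of_subset_of_card_le (fun x hx => Finset.mem_erase.2
          ⟨fun hxy => hyω (hxy ▸ hx), hωY hx⟩) ?_
        rw [Finset.card_erase_of_mem hy, hcard, ω.card_verts]
      have hmem : ∀ x, x ∈ ω.verts ↔ x ≠ y ∧ (x = a ∨ x = b ∨ x = c ∨ x = d) := by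
        intro x; rw [heq]; simp [hYdef]
      have hball : y ∉ ball o ρ := fun hyb => (he.subset ⟨hy, hyb⟩ : y ∈ (∅ : Set (Pt 2)))
      have hy' : y ∈ (Y : Set (Pt 2)) := hy
      rw [hYc] at hy'
      rcases hy' with rfl | rfl | rfl | rfl
      · right
        refine DSimplex.eq_of_subset fun x hx => ?_
        have := (hmem x).1 hx
        rw [hτ'.mem_iff]
        tauto
      · refine absurd (mem_ball.2 ?_) hball
        have e1 := ho a ((hmem _).2 ⟨h.ne_ab, by simp⟩)
        have e2 := ho c ((hmem _).2 ⟨h.ne_bc.symm, by simp⟩)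
        have e3 := ho d ((hmem _).2 ⟨h.ne_bd.symm, by simp⟩)
        exact h.swap_bd.dist_lt (by linarith) e1 e3 e2
      · left
        refine DSimplex.eq_of_subset fun x hx => ?_
        have := (hmem x).1 hx
        rw [hσ'.mem_iff]
        tauto
      · refine absurd (mem_ball.2 ?_) hball
        have e1 := ho a ((hmem _).2 ⟨h.ne_ad, by simp⟩)
        have e2 := ho b ((hmem _).2 ⟨h.ne_bd, by simp⟩)
        have e3 := ho c ((hmem _).2 ⟨h.ne_cd, by simp⟩)
        exact h.dist_lt hD e1 e2 e3
  · intro ω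
    simp only [Finset.mem_insert, Finset.mem_singleton, subset_univ, and_true]
    constructor
    · rintro (rfl | rfl)
      · exact ⟨ω.nonempty_verts, ω, by simp, subset_rfl⟩
      · exact ⟨ω.nonempty_verts, ω, by simp, subset_rfl⟩
    · rintro ⟨-, ω', hω', hs⟩
      rw [DSimplex.eq_of_subset hs]
      exact hω'

end Crossing

/-! ### A potential that decreases under flips -/

/-- Twice the signed area of the triangle `abc`. -/
def signedArea (a b c : Pt 2) : ℝ := (b 0 - a 0) * (c 1 - a 1) - (b 1 - a 1) * (c 0 - a 0)

theorem Indep3.signedArea_ne_zero {a b c : Pt 2} (h : Indep3 a b c) : signedArea a b c ≠ 0 := by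
  intro h0
  unfold signedArea at h0
  have key (i : Fin 2) : c i - a i = 0 ∧ b i - a i = 0 := by
    have := h (-((c i - a i) + -(b i - a i))) (c i - a i) (-(b i - a i)) (by ring) (by
      ext j
      simp only [PiLp.add_apply, PiLp.smul_apply, smul_eq_mul, PiLp.zero_apply]
      fin_cases i <;> fin_cases j <;> simp <;> linarith)
    exact ⟨this.2.1, neg_eq_zero.1 this.2.2⟩
  refine h.ne (PiLp.ext fun i => ?_)
  linarith [(key i).2]

/-- Twelve times the area of a triangle, as a symmetric expression in its vertices. -/
def DSimplex.areaSum (σ : DSimplex 2) : ℝ :=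
  ∑ x ∈ σ.verts, ∑ y ∈ σ.verts, ∑ z ∈ σ.verts, |signedArea x y z|

theorem DSimplex.IsTriangle.areaSum_eq {σ : DSimplex 2} {a b c : Pt 2} (h : σ.IsTriangle a b c) :
    σ.areaSum = 6 * |signedArea a b c| := by
  have e1 (x y : Pt 2) : signedArea x x y = 0 := by unfold signedArea; ring
  have e2 (x y : Pt 2) : signedArea x y x = 0 := by unfold signedArea; ring
  have e3 (x y : Pt 2) : signedArea x y y = 0 := by unfold signedArea; ring
  have f1 (x y z : Pt 2) : |signedArea x y z| = |signedArea y x z| := by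
    rw [← abs_neg]; congr 1; unfold signedArea; ring
  have f2 (x y z : Pt 2) : |signedArea x y z| = |signedArea y z x| := by
    congr 1; unfold signedArea; ring
  simp only [DSimplex.areaSum, h.sum_eq, e1, e2, e3, abs_zero]
  rw [f1 b a c, f2 c a b, f1 c b a, f2 b c a, f2 c a b, f1 a c b, f2 c a b]
  ring

/-- Up to a constant, the integral over `σ` of the linear interpolation of `‖x‖ ^ 2`. -/
noncomputable def DSimplex.liftedVolume (σ : DSimplex 2) : ℝ :=
  σ.areaSum * ∑ x ∈ σ.verts, ‖x‖ ^ 2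

/-- The areas of `abc`, `acd`, `abd`, `bcd` are proportional to `δ`, `β`, `γ`, `α`. The volume
therefore drops by a positive multiple of the quantity in `hD`. -/
theorem Crossing.liftedVolume_lt {a b c d : Pt 2} {α β γ δ : ℝ} {σ τ σ' τ' : DSimplex 2}
    (h : Crossing a b c d α β γ δ)
    (hD : 0 < α * ‖a‖ ^ 2 + γ * ‖c‖ ^ 2 - β * ‖b‖ ^ 2 - δ * ‖d‖ ^ 2)
    (hσ : σ.IsTriangle a b c) (hτ : τ.IsTriangle a c d)
    (hσ' : σ'.IsTriangle a b d) (hτ' : τ'.IsTriangle b c d) :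
    σ'.liftedVolume + τ'.liftedVolume < σ.liftedVolume + τ.liftedVolume := by
  have hδ := h.pos_d
  have hco (i : Fin 2) : d i = (α * a i + γ * c i - β * b i) / δ := by
    have := congrArg (fun x : Pt 2 => x i) h.eq
    simp only [PiLp.add_apply, PiLp.smul_apply, smul_eq_mul] at this
    rw [eq_div_iff hδ.ne']
    linarith
  have hα : α = 1 - γ := by linarith [h.sum_ac]
  have hβ : β = 1 - δ := by linarith [h.sum_bd]
  have e1 : signedArea a c d = β / δ * signedArea a b c := by
    unfold signedArea
    rw [hco 0, hco 1, hα, hβ]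
    field_simp
    ring
  have e2 : signedArea a b d = γ / δ * signedArea a b c := by
    unfold signedArea
    rw [hco 0, hco 1, hα, hβ]
    field_simp
    ring
  have e3 : signedArea b c d = α / δ * signedArea a b c := by
    unfold signedArea
    rw [hco 0, hco 1, hα, hβ]
    field_simp
    ring
  have hpos : 0 < |signedArea a b c| / δ := div_pos (abs_pos.2 h.indep.signedArea_ne_zero) hδ
  have hm : |signedArea a b c| = δ * (|signedArea a b c| / δ) := by field_simp
  simp only [DSimplex.liftedVolume, hσ.areaSum_eq, hτ.areaSum_eq, hσ'.areaSum_eq, hτ'.areaSum_eq,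
    hσ.sum_eq, hτ.sum_eq, hσ'.sum_eq, hτ'.sum_eq, e1, e2, e3, abs_mul,
    abs_of_pos (div_pos h.pos_a hδ), abs_of_pos (div_pos h.pos_b hδ),
    abs_of_pos (div_pos h.pos_c hδ)]
  set m := |signedArea a b c| / δ with hmdef
  have g1 : β / δ * |signedArea a b c| = β * m := by rw [hmdef]; ring
  have g2 : γ / δ * |signedArea a b c| = γ * m := by rw [hmdef]; ring
  have g3 : α / δ * |signedArea a b c| = α * m := by rw [hmdef]; ring
  rw [g1, g2, g3, hm]
  have := mul_pos hpos hD
  rw [hα, hβ] at this ⊢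
  linarith

/-! ### Locally Delaunay patches -/

/-- No pair of adjacent triangles of `K` can be flipped towards the Delaunay triangulation. -/
def IsLocallyDelaunay (K : Finset (DSimplex 2)) : Prop :=
  ∀ (a b c d : Pt 2) (α β γ δ : ℝ) (σ τ : DSimplex 2), σ ∈ K → τ ∈ K → σ.IsTriangle a b c →
    τ.IsTriangle a c d → Crossing a b c d α β γ δ →
    α * ‖a‖ ^ 2 + γ * ‖c‖ ^ 2 - β * ‖b‖ ^ 2 - δ * ‖d‖ ^ 2 ≤ 0

open Classical in
theorem IsPatch.sum_flip {X A : Set (Pt 2)} {q : ℝ} {K : Finset (DSimplex 2)}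
    (hK : IsPatch X q A K) {a b c d : Pt 2} {α β γ δ : ℝ} {σ τ σ' τ' : DSimplex 2}
    (h : Crossing a b c d α β γ δ) (hσK : σ ∈ K) (hτK : τ ∈ K) (hσ : σ.IsTriangle a b c)
    (hτ : τ.IsTriangle a c d) (hσ' : σ'.IsTriangle a b d) (hτ' : τ'.IsTriangle b c d)
    (f : DSimplex 2 → ℝ) :
    ∑ ω ∈ (K \ {σ, τ}) ∪ {σ', τ'}, f ω + (f σ + f τ) = ∑ ω ∈ K, f ω + (f σ' + f τ') := by
  have hnot : ∀ ω ∈ K, ¬(b ∈ ω.verts ∧ d ∈ ω.verts) := fun ω hω =>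
    h.not_mem_and_mem hσ (hK.inter σ hσK ω hω)
  have hdisj : Disjoint (K \ {σ, τ}) {σ', τ'} := by
    rw [Finset.disjoint_left]
    intro ω hω hω'
    have hωK := (Finset.mem_sdiff.1 hω).1
    rcases Finset.mem_insert.1 hω' with rfl | hω'
    · exact hnot _ hωK ⟨hσ'.mem2, hσ'.mem3⟩
    · rw [Finset.mem_singleton] at hω'
      subst hω'
      exact hnot _ hωK ⟨hτ'.mem1, hτ'.mem3⟩
  have hsub : ({σ, τ} : Finset (DSimplex 2)) ⊆ K := by
    intro ω hω
    rcases Finset.mem_insert.1 hω with rfl | hω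
    · exact hσK
    · rw [Finset.mem_singleton.1 hω]; exact hτK
  rw [Finset.sum_union hdisj,
    Finset.sum_pair (h.flip.ne_of_isTriangle hσ'.swap hτ'.rotate.rotate.swap),
    ← Finset.sum_sdiff hsub, Finset.sum_pair (h.ne_of_isTriangle hσ hτ)]
  ring

/-- Patches covering `A` use only the finitely many points of `X` in a ball, so some patch minimizes
the lifted volume among those not increasing the sum of `F`. Any remaining flip would contradict
minimality. -/
theorem IsPatch.exists_isLocallyDelaunay {X A : Set (Pt 2)} {q r : ℝ} {K₀ : Finset (DSimplex 2)}
    (hK₀ : IsPatch X q A K₀) (hr : 0 < r) (hX : IsSparse X r) (hgen : IsGeneric X)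
    {α : ℝ} (hA : A ⊆ closedBall 0 α) {F : DSimplex 2 → ℝ} (hF : F ∈ ClassF 2) :
    ∃ K, IsPatch X q A K ∧ ∑ σ ∈ K, F σ ≤ ∑ σ ∈ K₀, F σ ∧ IsLocallyDelaunay K := by
  classical
  have hfinS := finite_dSimplex_verts_subset (d := 2) (hX.finite_inter_closedBall hr 0 α)
  have hfin : {K | IsPatch X q A K ∧ ∑ σ ∈ K, F σ ≤ ∑ σ ∈ K₀, F σ}.Finite := by
    refine (hfinS.toFinset.powerset.finite_toSet).subset fun K hK => ?_
    rw [Finset.mem_coe, Finset.mem_powerset]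
    intro σ hσ
    rw [Finite.mem_toFinset]
    refine subset_inter (hK.1.verts_subset σ hσ) (σ.verts_subset_body.trans (Subset.trans ?_ hA))
    rw [← hK.1.cover]
    exact subset_biUnion_of_mem (u := fun σ : DSimplex 2 => σ.body) hσ
  obtain ⟨K, ⟨hK, hKF⟩, hmin⟩ := Set.exists_min_image _
    (fun K : Finset (DSimplex 2) => ∑ σ ∈ K, σ.liftedVolume) hfin ⟨K₀, hK₀, le_rfl⟩
  refine ⟨K, hK, hKF, fun a b c d α β γ δ σ τ hσK hτK hσ hτ h => ?_⟩
  by_contra! hD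
  obtain ⟨σ', hσ'⟩ := exists_isTriangle h.flip.indep.swap
  obtain ⟨τ', hτ'⟩ := exists_isTriangle h.swap_ac.flip.indep
  have hsumF := hK.sum_flip h hσK hτK hσ hτ hσ' hτ' F
  have hsumV := hK.sum_flip h hσK hτK hσ hτ hσ' hτ' DSimplex.liftedVolume
  have hgenY : IsGeneric ({a, b, c, d} : Set (Pt 2)) := by
    refine hgen.mono ?_
    have := hK.verts_subset σ hσK
    rintro x (rfl | rfl | rfl | rfl)
    exacts [this hσ.mem1, this hσ.mem2, this hσ.mem3, hK.verts_subset τ hτK hτ.mem3]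
  have hFle := h.add_le_add_of_mem_classF hD hgenY hF hσ hτ hσ' hτ'
  have hVlt := h.liftedVolume_lt hD hσ hτ hσ' hτ'
  have := hmin _ ⟨hK.flip h hD hσK hτK hσ hτ hσ' hτ', by linarith⟩
  linarith

/-- Points just beyond the midpoint of `ac`, away from `b`, are still covered. Finitely many closed
triangles allow choosing one that contains the midpoint as well; it then shares `a` and `c`, and its
third vertex must be beyond `ac`. -/
theorem IsPatch.exists_adjacent {X A : Set (Pt 2)} {q : ℝ} {K : Finset (DSimplex 2)}
    (hK : IsPatch X q A K) {a b c : Pt 2} {σ : DSimplex 2} (hσK : σ ∈ K) (hσ : σ.IsTriangle a b c)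
    (hA : A ∈ nhds ((1 / 2 : ℝ) • a + (0 : ℝ) • b + (1 / 2 : ℝ) • c)) :
    ∃ τ ∈ K, ∃ d, τ.IsTriangle a c d ∧ ∃ u v w : ℝ, u + v + w = 1 ∧ v < 0 ∧
      u • a + v • b + w • c = d := by
  set m := (1 / 2 : ℝ) • a + (0 : ℝ) • b + (1 / 2 : ℝ) • c with hm
  have hev : ∀ᶠ p in nhds m, p ∈ A ∧ ∀ τ ∈ K, m ∉ τ.body → p ∉ τ.body := by
    refine Filter.Eventually.and hA ((Finset.eventually_all K).2 fun τ _ => ?_)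
    by_cases hmτ : m ∈ τ.body
    · exact Eventually.of_forall fun p h => absurd hmτ h
    · filter_upwards [τ.isCompact_body.isClosed.isOpen_compl.mem_nhds hmτ] with p hp _ using hp
  have hcont : Continuous fun t : ℝ => ((1 + t) / 2) • a + (-t) • b + ((1 + t) / 2) • c := by
    fun_prop
  have h0 := hcont.tendsto 0
  simp only [add_zero, neg_zero] at h0
  obtain ⟨t, ⟨htA, htK⟩, ht0⟩ := (((h0.eventually hev).filter_mono
    (nhdsWithin_le_nhds (s := Ioi (0 : ℝ)))).and self_mem_nhdsWithin).exists
  rw [← hK.cover] at htA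
  obtain ⟨τ, hτK, hτ⟩ := mem_iUnion₂.1 htA
  have hmτ : m ∈ τ.body := by_contra fun h => htK τ hτK h hτ
  have hmσ : m ∈ σ.body :=
    hσ.mem_body_iff.2 ⟨_, _, _, by norm_num, le_rfl, by norm_num, by norm_num, rfl⟩
  obtain ⟨ha, -, hc⟩ := hσ.coords_of_mem_convexHull inter_subset_left (by norm_num)
    (hK.inter σ hσK τ hτK ⟨hmσ, hmτ⟩)
  obtain ⟨d, hd⟩ := τ.exists_third hσ.rotate.rotate.ne.symm (ha (by norm_num)).2
    (hc (by norm_num)).2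
  obtain ⟨u, v, w, h1, huvw⟩ := hσ.exists_coords d
  refine ⟨τ, hτK, d, hd, u, v, w, h1, ?_, huvw⟩
  obtain ⟨x, y, z, -, -, hz, hxyz, hp⟩ := hd.mem_body_iff.1 hτ
  have := (hσ.indep3 (x + z * u - (1 + t) / 2) (z * v - -t) (y + z * w - (1 + t) / 2)
    (by linear_combination hxyz + z * h1) (by
      rw [← huvw] at hp
      linear_combination (norm := module) hp)).2.1
  have ht : 0 < t := ht0
  by_contra! hv
  nlinarith [mul_nonneg hz hv]

theorem DSimplex.exists_coord_neg (σ : DSimplex 2) {x : Pt 2} (hx : x ∉ σ.body) :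
    ∃ a b c, σ.IsTriangle a b c ∧ ∃ u v w : ℝ, u + v + w = 1 ∧ v < 0 ∧
      u • a + v • b + w • c = x := by
  classical
  obtain ⟨a, b, c, -, -, -, h⟩ := Finset.card_eq_three.1 σ.card_verts
  have hσ : σ.IsTriangle a b c := by rw [DSimplex.IsTriangle, h]; simp
  obtain ⟨u, v, w, h1, hp⟩ := hσ.exists_coords x
  by_cases hv : v < 0
  · exact ⟨a, b, c, hσ, u, v, w, h1, hv, hp⟩
  by_cases hu : u < 0
  · exact ⟨b, a, c, hσ.swap, v, u, w, by linarith, hu, by rw [← hp]; module⟩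
  by_cases hw : w < 0
  · exact ⟨b, c, a, hσ.rotate, v, w, u, by linarith, hw, by rw [← hp]; module⟩
  push Not at hu hv hw
  exact absurd (hσ.mem_body_iff.2 ⟨u, v, w, hu, hv, hw, h1, hp⟩) hx

/-- If some circumdisc contains `x`, take the triangle for which the power of `x` is least. Crossing
the edge that separates it from `x` leads to a neighbor for which the power is still smaller. The
room around `x` guarantees that this neighbor exists, as the midpoint of the edge lies within `2 *
q` of `x`. -/
theorem IsPatch.le_dist_of_isLocallyDelaunay {X A : Set (Pt 2)} {q : ℝ}
    {K : Finset (DSimplex 2)} (hK : IsPatch X q A K) (hloc : IsLocallyDelaunay K)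
    (hgen : IsGeneric X) {cen : DSimplex 2 → Pt 2} {rad : DSimplex 2 → ℝ}
    (hcs : ∀ σ ∈ K, σ.IsCircumsphere (cen σ) (rad σ) ∧ rad σ ≤ q) {x : Pt 2} (hx : x ∈ X)
    (hxA : ball x (2 * q + 1) ⊆ A) {σ : DSimplex 2} (hσK : σ ∈ K) : rad σ ≤ dist x (cen σ) := by
  classical
  by_contra! hlt
  obtain ⟨σ₀, hσ₀K, hmin⟩ := K.exists_min_image (fun σ => dist x (cen σ) ^ 2 - rad σ ^ 2) ⟨σ, hσK⟩
  have hlt₀ : dist x (cen σ₀) < rad σ₀ := by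
    refine lt_of_pow_lt_pow_left₀ 2 (hcs σ₀ hσ₀K).1.nonneg ?_
    have h1 := hmin σ hσK
    have h2 : dist x (cen σ) ^ 2 < rad σ ^ 2 := pow_lt_pow_left₀ hlt dist_nonneg two_ne_zero
    linarith
  obtain ⟨hc₀, hq₀⟩ := hcs σ₀ hσ₀K
  have hxσ₀ : x ∉ σ₀.body := fun hxb =>
    hlt₀.ne (hc₀ x (hK.vertex σ₀ hσ₀K ⟨hx, hxb⟩))
  obtain ⟨a, b, c, hσ₀, u, v, w, h1, hv, hp⟩ := σ₀.exists_coord_neg hxσ₀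
  have ha := hc₀ a hσ₀.mem1
  have hb := hc₀ b hσ₀.mem2
  have hc := hc₀ c hσ₀.mem3
  obtain ⟨τ, hτK, d, hτ, u', v', w', h1', hv', hp'⟩ := hK.exists_adjacent hσ₀K hσ₀ (by
    refine mem_of_superset (isOpen_ball.mem_nhds ?_) hxA
    have hmb := hc₀.body_subset (hσ₀.mem_body_iff.2 ⟨1 / 2, 0, 1 / 2, by norm_num, le_rfl,
      by norm_num, by norm_num, rfl⟩)
    rw [mem_closedBall] at hmb
    rw [mem_ball]
    have := dist_triangle_right ((1 / 2 : ℝ) • a + (0 : ℝ) • b + (1 / 2 : ℝ) • c) x (cen σ₀)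
    linarith)
  have hcτ := (hcs τ hτK).1
  rcases lt_trichotomy (dist d (cen σ₀)) (rad σ₀) with hd | hd | hd
  · obtain ⟨α, β, γ, δ, h, hD⟩ := exists_crossing hσ₀.indep3 ha hb hc hd hv' h1' hp'
    exact absurd (hloc a b c d α β γ δ σ₀ τ hσ₀K hτK hσ₀ hτ h) (not_le.2 hD)
  · have hbd : b ≠ d := by
      rintro rfl
      have := (hσ₀.indep3 u' (v' - 1) w' (by linarith)
        (by linear_combination (norm := module) hp')).2.1
      linarith
    have hcard : ({a, b, c, d} : Finset (Pt 2)).card = 2 + 2 := by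
      rw [Finset.card_insert_of_notMem (by
          simp [hσ₀.ne, hσ₀.rotate.rotate.ne.symm, hτ.rotate.rotate.ne.symm]),
        Finset.card_insert_of_notMem (by simp [hσ₀.rotate.ne, hbd]),
        Finset.card_pair hτ.rotate.ne]
    refine hgen {a, b, c, d} ?_ hcard ⟨cen σ₀, rad σ₀, ?_⟩
    · simp only [Finset.coe_insert, Finset.coe_singleton, insert_subset_iff, singleton_subset_iff]
      have := hK.verts_subset σ₀ hσ₀K
      exact ⟨this hσ₀.mem1, this hσ₀.mem2, this hσ₀.mem3, hK.verts_subset τ hτK hτ.mem3⟩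
    · simp only [Finset.coe_insert, Finset.coe_singleton]
      rintro y (rfl | rfl | rfl | rfl) <;> assumption
  -- The power with respect to `τ` minus that with respect to `σ₀` is affine and vanishes on the
  -- line `ac`. It is negative at `d`, hence also at `x` on the same side, against minimality.
  · have e1 := sum_weights_sq_dist_triple (cen τ) (cen σ₀) h1 hp
    have e2 := sum_weights_sq_dist_triple (cen τ) (cen σ₀) h1' hp'
    rw [ha, hb, hc, hcτ a hτ.mem1, hcτ c hτ.mem2] at e1 e2
    rw [hcτ d hτ.mem3] at e2
    have hd2 : rad σ₀ ^ 2 < dist d (cen σ₀) ^ 2 := pow_lt_pow_left₀ hd hc₀.nonneg two_ne_zero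
    have hm := hmin τ hτK
    have e3 : v' * (dist b (cen τ) ^ 2 - rad τ ^ 2) = rad σ₀ ^ 2 - dist d (cen σ₀) ^ 2 := by
      linear_combination e2 - (rad τ ^ 2 - rad σ₀ ^ 2) * h1'
    have e4 : v * (dist b (cen τ) ^ 2 - rad τ ^ 2) =
        (dist x (cen τ) ^ 2 - rad τ ^ 2) - (dist x (cen σ₀) ^ 2 - rad σ₀ ^ 2) := by
      linear_combination e1 - (rad τ ^ 2 - rad σ₀ ^ 2) * h1
    have e5 : 0 < dist b (cen τ) ^ 2 - rad τ ^ 2 := by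
      by_contra! hle
      nlinarith
    nlinarith [mul_neg_of_neg_of_pos hv e5]

/-! ### The theorem for the class `ClassF` in the plane -/

open Classical in
theorem isPatch_of_triangulation {T : Geometry.SimplicialComplex ℝ (Pt 2)} {q : ℝ}
    (hq : ∀ σ : DSimplex 2, σ.verts ∈ T.faces → σ.CircumradiusLE q) (K : Finset (DSimplex 2))
    (hK : ∀ σ ∈ K, σ.verts ∈ T.faces) :
    IsPatch T.vertices q (⋃ σ ∈ K, σ.body) K where
  verts_subset σ hσ := faces_subset_vertices T (hK σ hσ)
  circumradiusLE σ hσ := hq σ (hK σ hσ)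
  inter σ hσ τ hτ := T.inter_subset_convexHull (hK σ hσ) (hK τ hτ)
  cover := rfl
  vertex σ hσ _ hx := mem_verts_of_mem_body (hK σ hσ) hx.1 hx.2

theorem density_delaunay_le_of_mem_classF {X : Set (Pt 2)} (hX : IsDelaunaySet X)
    (hgen : IsGeneric X) {F : DSimplex 2 → ℝ} (hF : F ∈ ClassF 2)
    {T : Geometry.SimplicialComplex ℝ (Pt 2)} (hT : IsTriangulation T X)
    (hTq : IsUniformlyBounded T) : density F (delaunay X) ≤ density F T.faces := by
  classical
  obtain ⟨r, R, hr, hrR, hXr, hXR⟩ := hX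
  have hsp := isSparse_of_subsingleton_inter_ball hXr
  obtain ⟨q, hq, hq0⟩ : ∃ q : ℝ, (∀ σ : DSimplex 2, σ.verts ∈ T.faces → σ.CircumradiusLE q) ∧
      0 < q := by
    obtain ⟨q, hq⟩ := hTq
    exact ⟨max q 1, fun σ hσ => (hq σ hσ).mono (le_max_left _ _), by positivity⟩
  have hR : 0 < R := hr.trans hrR
  obtain ⟨M, hM, hFM⟩ := ClassE.exists_bound hF.1 hr hsp (lt_max_of_lt_left hq0 : 0 < max q R)
  obtain ⟨rfl, hTs⟩ := hT
  -- Passing from a vertex of a Delaunay triangle to its barycenter costs `2 * R`, and on to a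
  -- vertex of the patch triangle there `2 * q`; the depth `6 * q + 1` required by `hdeep` remains.
  refine density_le_of_shell hr hsp F _ _ (q := max q R) (C := 2 * R + 8 * q + 1) hM
    (by positivity) ?_
  refine Eventually.of_forall fun α => ?_
  have hfinD := finite_faces_in_closedBall hr hsp (delaunay T.vertices)
    (fun s hs => by
      obtain ⟨_, σ, hσ, hsσ⟩ := hs
      exact (Finset.coe_subset.2 hsσ).trans hσ.1) 0 α
  have hfinT := finite_faces_in_closedBall hr hsp T.faces (fun s => faces_subset_vertices T) 0 α
  set D := hfinD.toFinset with hD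
  set K₀ := hfinT.toFinset with hK₀
  have hmemD (σ : DSimplex 2) : σ ∈ D ↔ σ.IsEmptyIn T.vertices ∧ σ.body ⊆ closedBall 0 α := by
    rw [hD, hfinD.mem_toFinset, ← DSimplex.verts_mem_delaunay]; rfl
  have hmemK₀ (σ : DSimplex 2) : σ ∈ K₀ ↔ σ.verts ∈ T.faces ∧ σ.body ⊆ closedBall 0 α :=
    hfinT.mem_toFinset
  have hpatch₀ := isPatch_of_triangulation hq K₀ fun σ hσ => ((hmemK₀ σ).1 hσ).1
  set A := ⋃ σ ∈ K₀, σ.body with hA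
  have hAα : A ⊆ closedBall 0 α := iUnion₂_subset fun σ hσ => ((hmemK₀ σ).1 hσ).2
  have hαA : closedBall 0 (α - 2 * q) ⊆ A := by
    intro y hy
    obtain ⟨τ, hτ, hyτ⟩ := exists_dSimplex_of_mem_space hr hsp hTs hq y
    refine mem_biUnion (x := τ) ((hmemK₀ τ).2 ⟨hτ, fun z hz => ?_⟩) hyτ
    rw [mem_closedBall_zero_iff] at hy ⊢
    have h2 := (hq τ hτ).dist_le hz hyτ
    rw [dist_eq_norm] at h2
    linarith [norm_sub_norm_le z y]
  obtain ⟨K, hK, hKF, hloc⟩ := hpatch₀.exists_isLocallyDelaunay hr hsp hgen hAα hF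
  choose! cen rad hcs using hK.circumradiusLE
  -- A point of the circumdisc is within `2 * q` of `v`, and the ball of radius `2 * q + 1` around
  -- it must stay in the radius `α - 2 * q` known to be covered.
  have hdeep : ∀ σ ∈ K, ∀ v ∈ σ.verts, ‖v‖ ≤ α - (6 * q + 1) → σ.IsEmptyIn T.vertices := by
    intro σ hσ v hv hvα
    refine ⟨hK.verts_subset σ hσ, cen σ, rad σ, (hcs σ hσ).1, ?_⟩
    rw [eq_empty_iff_forall_notMem]
    rintro x ⟨hx, hxb⟩
    rw [mem_ball] at hxb
    refine absurd (hK.le_dist_of_isLocallyDelaunay hloc hgen hcs hx (fun y hy => hαA ?_) hσ)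
      (not_le.2 hxb)
    have h1 := dist_triangle_right x v (cen σ)
    rw [(hcs σ hσ).1 v hv, dist_eq_norm] at h1
    rw [mem_ball, dist_eq_norm] at hy
    rw [mem_closedBall_zero_iff]
    linarith [norm_sub_norm_le y x, norm_sub_norm_le x v, (hcs σ hσ).2]
  have hKbody : ∀ σ ∈ K, σ.body ⊆ A := fun σ hσ => by
    rw [← hK.cover]
    exact subset_biUnion_of_mem (u := fun σ : DSimplex 2 => σ.body) hσ
  have hmemS : ∀ σ ∈ symmDiff D K, (σ.verts : Set (Pt 2)) ⊆ T.vertices ∧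
      σ.CircumradiusLE (max q R) := by
    intro σ hσ
    rcases Finset.mem_symmDiff.1 hσ with ⟨h, -⟩ | ⟨h, -⟩
    · have := ((hmemD σ).1 h).1
      exact ⟨this.1, (this.circumradiusLE hXR).mono (le_max_right _ _)⟩
    · exact ⟨hK.verts_subset σ h, (hK.circumradiusLE σ h).mono (le_max_left _ _)⟩
  refine ⟨symmDiff D K, fun σ hσ => ⟨(hmemS σ hσ).2, (hmemS σ hσ).1, fun v hv => ?_⟩, ?_⟩
  · rcases Finset.mem_symmDiff.1 hσ with ⟨hσD, hσK⟩ | ⟨hσK, hσD⟩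
    · obtain ⟨hem, hbody⟩ := (hmemD σ).1 hσD
      refine ⟨mem_closedBall_zero_iff.1 (hbody (σ.verts_subset_body hv)), ?_⟩
      by_contra! hle
      -- The barycenter has all weights positive, as `DSimplex.IsEmptyIn.eq_of_mem_body` needs to
      -- identify `σ` with the patch triangle containing it.
      have hw1 : ∑ y ∈ σ.verts, (3 : ℝ)⁻¹ = 1 := by
        rw [Finset.sum_const, σ.card_verts]; norm_num
      have hpb : ∑ y ∈ σ.verts, (3 : ℝ)⁻¹ • y ∈ σ.body :=
        (convex_convexHull ℝ _).sum_mem (fun _ _ => by norm_num) hw1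
          (fun y hy => σ.verts_subset_body hy)
      set p := ∑ y ∈ σ.verts, (3 : ℝ)⁻¹ • y with hp
      have hpv := (hem.circumradiusLE hXR).dist_le hpb (σ.verts_subset_body hv)
      rw [dist_eq_norm] at hpv
      have hpα : ‖p‖ ≤ α - 8 * q - 1 := by linarith [norm_sub_norm_le p v]
      have hpA : p ∈ A := hαA (mem_closedBall_zero_iff.2 (by linarith))
      rw [← hK.cover] at hpA
      obtain ⟨τ, hτK, hpτ⟩ := mem_iUnion₂.1 hpA
      obtain ⟨t, ht⟩ := τ.nonempty_verts
      have htp := (hK.circumradiusLE τ hτK).dist_le (τ.verts_subset_body ht) hpτ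
      rw [dist_eq_norm] at htp
      have hτem := hdeep τ hτK t ht (by linarith [norm_sub_norm_le t p])
      have := hem.eq_of_mem_body hgen hτem (w := fun _ => (3 : ℝ)⁻¹) (fun _ _ => by norm_num)
        hw1 hpτ
      exact hσK (this ▸ hτK)
    · refine ⟨mem_closedBall_zero_iff.1 (hAα (hKbody σ hσK (σ.verts_subset_body hv))), ?_⟩
      by_contra! hle
      exact hσD ((hmemD σ).2 ⟨hdeep σ hσK v hv (by linarith), (hKbody σ hσK).trans hAα⟩)
  · rw [simplexSum_eq_sum F (delaunay T.vertices) (closedBall 0 α) D (by simp [hD]),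
      simplexSum_eq_sum F T.faces (closedBall 0 α) K₀ hmemK₀]
    have hb : ∀ σ ∈ symmDiff D K, |F σ| ≤ M := fun σ hσ =>
      hFM σ (hmemS σ hσ).1 (hmemS σ hσ).2
    have := sum_sub_sum_le_card_symmDiff D K F M
      (fun σ hσ => hb σ (Finset.mem_symmDiff.2 (Or.inl (Finset.mem_sdiff.1 hσ))))
      (fun σ hσ => hb σ (Finset.mem_symmDiff.2 (Or.inr (Finset.mem_sdiff.1 hσ))))
    linarith

theorem mainTheorem1 :
    (∀ X : Set (Pt 2), IsDelaunaySet X → IsGeneric X →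
      ∀ F : DSimplex 2 → ℝ, F ∈ ClassF 2 →
      ∀ T : Geometry.SimplicialComplex ℝ (Pt 2), IsTriangulation T X → IsUniformlyBounded T →
        density F (delaunay X) ≤ density F T.faces) ∧
    (∀ (d : ℕ) (X : Set (Pt d)), IsDelaunaySet X → IsGeneric X →
      ∀ F : DSimplex d → ℝ, F ∈ ClassG d →
      ∀ T : Geometry.SimplicialComplex ℝ (Pt d), IsTriangulation T X → IsUniformlyBounded T →
        density F (delaunay X) ≤ density F T.faces) :=
  ⟨fun _ hX hgen _ hF _ hT hTq => density_delaunay_le_of_mem_classF hX hgen hF hT hTq,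
    fun _ _ hX hgen _ hF _ hT hTq => density_delaunay_le_of_mem_classG hX hgen hF hT hTq⟩
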